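/- Let $F$ be a field, let $n\ge 0$, and let $\lambda=(\lambda_a)_{a\in\mathbb Z}$, $\mu=(\mu_a)_{a\in\mathbb Z}$ be sequences in $F$ (only the terms with $|a|\le n-2$ matter). For a sequence $f$ write $(s^{\pm1}f)_a=f_{a\pm1}$, and let $A_{i_1,\dots,i_k}^{j_1,\dots,j_k}$ denote $A$ with rows $i_1,\dots,i_k$ and columns $j_1,\dots,j_k$ erased. The generalized Lambda-determinant $|A|_{\lambda,\mu}$ of an $n\times n$ matrix $A=(a_{i,j})$ is defined recursively: it is $1$ for $n=0$, it is $a$ for the $1\times1$ matrix $(a)$, and for $n\ge2$ $$|A|_{\lambda,\mu}=\frac{\mu_0\,|A_1^1|_{\lambda,s\mu}\,|A_n^n|_{\lambda,s^{-1}\mu}+\lambda_0\,|A_1^n|_{s^{-1}\lambda,\mu}\,|A_n^1|_{s\lambda,\mu}}{|A_{1,n}^{1,n}|_{\lambda,\mu}} .$$ Equivalently, $|A|_{\lambda,\mu}=T_{0,0,n}$ for the solution of $T_{i,j,k+1}T_{i,j,k-1}=\mu_jT_{i,j+1,k}T_{i,j-1,k}+\lambda_iT_{i+1,j,k}T_{i-1,j,k}$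 with $T_{i,j,0}=1$ and $T_{i,j,1}=a_{(j-i+n+1)/2,\,(i+j+n+1)/2}$. The definition makes sense if none of the denominators met in the recursion vanishes. An alternating sign matrix (ASM) is a square matrix $B=(b_{i,j})$ with entries in $\{0,1,-1\}$, in each row and column of which the entries sum to $1$ and the nonzero entries alternate in sign. An $n\times n$ ASM $B$ corresponds to exactly one six-vertex configuration on the $n\times n$ grid with domain wall boundary conditions, that is, an orientation of the edges such that every vertex has two incoming and two outgoing edges, the external horizontal edges point towards the grid and the external vertical edges point out of it; the correspondence is that $b_{i,j}=1$ at the vertices of type $c_1$, $b_{i,j}=-1$ at those of type $c_2$, and $b_{i,j}=0$ at all others. The type $\mathcal C(B)_{i,j}$ of the vertex in row $i$ (counted from the top) and column $j$ is: $a_1$ if its horizontal edges point right and its vertical ones up; $a_2$ if left and down; $b_1$ if right and down; $b_2$ if left and up; $c_1$ if its horizontal edges point in and its vertical ones out; $c_2$ if its horizontal edges point out and its vertical ones in. Whenever the definition of $|A|_{\lambda,\mu}$ makes sense, $$|A|_{\lambda,\mu}=\sum_{B\ n\times n\ \mathrm{ASM}}\ \prod_{i,j=1}^n w_{i,j}(A,B;\lambda,\mu),\qquad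 w_{i,j}(A,B;\lambda,\mu)=(a_{i,j})^{b_{i,j}}\times\begin{cases}\lambda_{j-i}&\text{if }\mathcal C(B)_{i,j}=a_1,\\ \mu_{i+j-n-1}&\text{if }\mathcal C(B)_{i,j}=b_1,\\ \lambda_{j-i}+\mu_{i+j-n-1}&\text{if }\mathcal C(B)_{i,j}=c_2,\\ 1&\text{otherwise.}\end{cases}$$ Moreover, if $\lambda_a\ne0$ and $\mu_a\ne0$ for all $|a|\le n-2$, then the definition makes sense for the matrix of independent indeterminates over the field $F(a_{i,j}:1\le i,j\le n)$, so that the formula holds as an identity of rational functions in the $a_{i,j}$. -/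

import Mathlib

namespace LambdaDet

/-! ### The generalized Lambda-determinant -/

/-- The `k`-th power `s ^ k` of the shift operator on sequences: `(s ^ k f)_a = f_{a + k}`. -/
def shift {F : Type*} (k : ℤ) (f : ℤ → F) : ℤ → F := fun a => f (a + k)

section Minors

variable {F : Type*} {n : ℕ}

/-- `A` with its first row and first column erased. -/
def minorFF (A : Matrix (Fin (n + 1)) (Fin (n + 1)) F) : Matrix (Fin n) (Fin n) F :=
  A.submatrix Fin.succ Fin.succ

/-- `A` with its last row and last column erased. -/
def minorLL (A : Matrix (Fin (n + 1)) (Fin (n + 1)) F) : Matrix (Fin n) (Fin n) F :=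
  A.submatrix Fin.castSucc Fin.castSucc

/-- `A` with its first row and last column erased. -/
def minorFL (A : Matrix (Fin (n + 1)) (Fin (n + 1)) F) : Matrix (Fin n) (Fin n) F :=
  A.submatrix Fin.succ Fin.castSucc

/-- `A` with its last row and first column erased. -/
def minorLF (A : Matrix (Fin (n + 1)) (Fin (n + 1)) F) : Matrix (Fin n) (Fin n) F :=
  A.submatrix Fin.castSucc Fin.succ

/-- `A` with its first and last rows and its first and last columns erased. -/
def interior (A : Matrix (Fin (n + 2)) (Fin (n + 2)) F) : Matrix (Fin n) (Fin n) F :=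
  A.submatrix (fun i => i.castSucc.succ) (fun j => j.castSucc.succ)

end Minors

/-- The generalized Lambda-determinant, computed by the modified Dodgson condensation. This is the
solution `T_{0,0,n}` of the inhomogeneous `T`-system
`T_{i,j,k+1} T_{i,j,k-1} = μ_j T_{i,j+1,k} T_{i,j-1,k} + λ_i T_{i+1,j,k} T_{i-1,j,k}` with
`T_{i,j,0} = 1` and `T_{i,j,1} = a_{(j-i+n+1)/2,(i+j+n+1)/2}`: here `T_{i,j,k}` belongs to the
contiguous `k × k` submatrix centred at row `(j-i+n+1)/2` and column `(i+j+n+1)/2`, with the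
sequence `λ` shifted by `i` and the sequence `μ` shifted by `j`. Hence erasing the first (last) row
and column shifts only `μ`, and erasing opposite ones shifts only `λ`.
It is meaningful only when no division by zero occurs, see `Condensable`. -/
def lambdaDet {F : Type*} [Field F] :
    (n : ℕ) → Matrix (Fin n) (Fin n) F → (ℤ → F) → (ℤ → F) → F
  | 0, _, _, _ => 1
  | 1, A, _, _ => A 0 0
  | n + 2, A, lam, mu =>
      (mu 0 * lambdaDet (n + 1) (minorFF A) lam (shift 1 mu)
            * lambdaDet (n + 1) (minorLL A) lam (shift (-1) mu)
        + lam 0 * lambdaDet (n + 1) (minorFL A) (shift (-1) lam) mu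
            * lambdaDet (n + 1) (minorLF A) (shift 1 lam) mu)
      / lambdaDet n (interior A) lam mu

/-- The recursive definition of the generalized Lambda-determinant makes sense: no denominator
met in the course of the recursion vanishes. -/
def Condensable {F : Type*} [Field F] :
    (n : ℕ) → Matrix (Fin n) (Fin n) F → (ℤ → F) → (ℤ → F) → Prop
  | 0, _, _, _ => True
  | 1, _, _, _ => True
  | n + 2, A, lam, mu =>
      Condensable (n + 1) (minorFF A) lam (shift 1 mu) ∧
      Condensable (n + 1) (minorLL A) lam (shift (-1) mu) ∧
      Condensable (n + 1) (minorFL A) (shift (-1) lam) mu ∧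
      Condensable (n + 1) (minorLF A) (shift 1 lam) mu ∧
      Condensable n (interior A) lam mu ∧
      lambdaDet n (interior A) lam mu ≠ 0

/-! ### Alternating sign matrices -/

/-- The sum of the first `k` entries of row `i`. -/
def rowSum {n : ℕ} (B : Matrix (Fin n) (Fin n) ℤ) (i : Fin n) (k : ℕ) : ℤ :=
  ∑ j : Fin n, if (j : ℕ) < k then B i j else 0

/-- The sum of the first `k` entries of column `j`. -/
def colSum {n : ℕ} (B : Matrix (Fin n) (Fin n) ℤ) (k : ℕ) (j : Fin n) : ℤ :=
  ∑ i : Fin n, if (i : ℕ) < k then B i j else 0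

/-- Alternating sign matrices: the entries are `0`, `1`, `-1`, the rows and columns sum to `1`, and
the partial sums of each row and column are `0` or `1` (that is, the nonzero entries of each row
and column alternate in sign, starting and ending with `1`). -/
structure IsASM {n : ℕ} (B : Matrix (Fin n) (Fin n) ℤ) : Prop where
  entry : ∀ i j, B i j = -1 ∨ B i j = 0 ∨ B i j = 1
  row_partial : ∀ i, ∀ k ≤ n, rowSum B i k = 0 ∨ rowSum B i k = 1
  col_partial : ∀ j, ∀ k ≤ n, colSum B k j = 0 ∨ colSum B k j = 1
  row_total : ∀ i, ∑ j, B i j = 1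
  col_total : ∀ j, ∑ i, B i j = 1

/-- The type of `n × n` alternating sign matrices. -/
def ASM (n : ℕ) : Type := {B : Matrix (Fin n) (Fin n) ℤ // IsASM B}

instance (n : ℕ) : Finite (ASM n) := by
  have h : Set.Finite {B : Fin n → Fin n → ℤ | ∀ i, B i ∈ {v : Fin n → ℤ |
      ∀ j, v j ∈ ({-1, 0, 1} : Set ℤ)}} :=
    Set.Finite.pi' fun _ => Set.Finite.pi' fun _ => Set.toFinite _
  exact Set.Finite.subset (s := {B : Fin n → Fin n → ℤ | ∀ i, B i ∈ {v : Fin n → ℤ |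
      ∀ j, v j ∈ ({-1, 0, 1} : Set ℤ)}}) h
    (t := {B : Fin n → Fin n → ℤ | IsASM (n := n) B}) fun B hB i j => hB.entry i j

noncomputable instance (n : ℕ) : Fintype (ASM n) := Fintype.ofFinite _

/-! ### The six-vertex model with domain wall boundary conditions -/

/-- A six-vertex configuration with domain wall boundary conditions on the `n × n` grid, whose
vertices `(i, j)` are indexed as matrix positions (`i` grows downwards, `j` to the right).
The edges of vertex `(i, j)` are: west `right i j`, east `right i (j + 1)`, north `up i j`,
south `up (i + 1) j`. -/
@[ext]
structure SixVertexDWBC (n : ℕ) where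
  /-- whether the `k`-th horizontal edge of row `i` points to the right -/
  right : Fin n → Fin (n + 1) → Bool
  /-- whether the `k`-th vertical edge of column `j` points up -/
  up : Fin (n + 1) → Fin n → Bool
  /-- each vertex has two incoming (hence two outgoing) edges -/
  ice : ∀ i j, (right i j.castSucc).toNat + (!right i j.succ).toNat
    + (!up i.castSucc j).toNat + (up i.succ j).toNat = 2
  /-- external horizontal edges point towards the grid -/
  west : ∀ i, right i 0 = true
  east : ∀ i, right i (Fin.last n) = false
  /-- external vertical edges point out of the grid -/
  north : ∀ j, up 0 j = true
  south : ∀ j, up (Fin.last n) j = false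

/-- The six local configurations. With the directions in which the arrows run:
`a₁` right and up, `a₂` left and down, `b₁` right and down, `b₂` left and up;
`c₁`: horizontal edges in, vertical edges out; `c₂`: horizontal edges out, vertical edges in. -/
inductive VertexType
  | a₁ | a₂ | b₁ | b₂ | c₁ | c₂

/-- The configuration of the vertex `(i, j)`. The west, east and north edges suffice, since
by the ice rule they determine the south edge. -/
def SixVertexDWBC.vertex {n : ℕ} (C : SixVertexDWBC n) (i j : Fin n) : VertexType :=
  match C.right i j.castSucc, C.right i j.succ, C.up i.castSucc j with
  | true, true, true => .a₁
  | false, false, false => .a₂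
  | true, true, false => .b₁
  | false, false, true => .b₂
  | true, false, _ => .c₁
  | false, true, _ => .c₂

/-- The matrix entry that corresponds to a local configuration. -/
def VertexType.entry : VertexType → ℤ
  | .c₁ => 1
  | .c₂ => -1
  | _ => 0

theorem rowSum_succ {n : ℕ} (B : Matrix (Fin n) (Fin n) ℤ) (i j : Fin n) :
    rowSum B i (j + 1) = rowSum B i j + B i j := by
  have h : B i j = ∑ k : Fin n, if k = j then B i k else 0 := by simp
  rw [rowSum, rowSum, h, ← Finset.sum_add_distrib]
  refine Finset.sum_congr rfl fun k _ => ?_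
  rcases lt_trichotomy k j with hk | hk | hk
  · simp [hk.ne, Fin.lt_def.1 hk, (Fin.lt_def.1 hk).trans (Nat.lt_succ_self _)]
  · simp [hk]
  · have := Fin.lt_def.1 hk
    simp [hk.ne', show ¬ (k : ℕ) < j + 1 by omega, show ¬ (k : ℕ) < j by omega]

theorem colSum_succ {n : ℕ} (B : Matrix (Fin n) (Fin n) ℤ) (i j : Fin n) :
    colSum B (i + 1) j = colSum B i j + B i j :=
  rowSum_succ B.transpose j i

theorem IsASM.rowSum_last {n : ℕ} {B : Matrix (Fin n) (Fin n) ℤ} (hB : IsASM B) (i : Fin n) :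
    rowSum B i n = 1 := by
  simpa [rowSum] using hB.row_total i

theorem IsASM.colSum_last {n : ℕ} {B : Matrix (Fin n) (Fin n) ℤ} (hB : IsASM B) (j : Fin n) :
    colSum B n j = 1 := by
  simpa [colSum] using hB.col_total j

/-- The six-vertex configuration `C(B)` of an alternating sign matrix `B`: a horizontal edge points
right if and only if the entries of `B` to its left sum to `0`, a vertical edge points up if and
only if the entries of `B` above it sum to `0`. By `config_unique` below, it is the only
configuration whose `c₁` vertices are the entries `1` of `B` and whose `c₂` vertices are the
entries `-1` of `B`. -/
def ASM.config {n : ℕ} (B : ASM n) : SixVertexDWBC n where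
  right i k := decide (rowSum B.1 i k = 0)
  up k j := decide (colSum B.1 k j = 0)
  ice i j := by
    have h1 := B.2.row_partial i j j.2.le
    have h2 := B.2.row_partial i (j + 1) j.2
    have h3 := B.2.col_partial j i i.2.le
    have h4 := B.2.col_partial j (i + 1) i.2
    have h5 := rowSum_succ B.1 i j
    have h6 := colSum_succ B.1 i j
    simp only [Fin.val_castSucc, Fin.val_succ]
    rcases h1 with h1 | h1 <;> rcases h2 with h2 | h2 <;> rcases h3 with h3 | h3 <;>
      rcases h4 with h4 | h4 <;> simp [h1, h2, h3, h4] <;> omega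
  west i := by simp [rowSum]
  east i := by simp [B.2.rowSum_last]
  north j := by simp [colSum]
  south j := by simp [B.2.colSum_last]

theorem ASM.entry_config {n : ℕ} (B : ASM n) (i j : Fin n) :
    (B.config.vertex i j).entry = B.1 i j := by
  have h1 := B.2.row_partial i j j.2.le
  have h2 := B.2.row_partial i (j + 1) j.2
  have h3 := B.2.col_partial j i i.2.le
  have h5 := rowSum_succ B.1 i j
  rcases h1 with h1 | h1 <;> rcases h2 with h2 | h2 <;> rcases h3 with h3 | h3 <;>
    simp [SixVertexDWBC.vertex, ASM.config, VertexType.entry, h1, h2, h3] <;> omega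

theorem ASM.config_unique {n : ℕ} (B : ASM n) (C : SixVertexDWBC n)
    (hC : ∀ i j, (C.vertex i j).entry = B.1 i j) : C = B.config := by
  have key : ∀ D : SixVertexDWBC n, ∀ i j,
      (D.vertex i j).entry = (D.right i j.castSucc).toNat - (D.right i j.succ).toNat ∧
      (D.vertex i j).entry = (D.up i.castSucc j).toNat - (D.up i.succ j).toNat := by
    intro D i j
    have h := D.ice i j
    revert h
    unfold SixVertexDWBC.vertex
    cases D.right i j.castSucc <;> cases D.right i j.succ <;> cases D.up i.castSucc j <;>
      cases D.up i.succ j <;> simp [VertexType.entry]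
  have inj : ∀ a b : Bool, a.toNat = b.toNat → a = b := by decide
  have hr : ∀ i k, C.right i k = B.config.right i k := by
    intro i k
    induction k using Fin.induction with
    | zero => rw [C.west, B.config.west]
    | succ j ih =>
      have h1 := (key C i j).1
      have h2 := (key B.config i j).1
      rw [hC, ih] at h1
      rw [B.entry_config] at h2
      exact inj _ _ (by omega)
  have hu : ∀ k j, C.up k j = B.config.up k j := by
    intro k j
    induction k using Fin.induction with
    | zero => rw [C.north, B.config.north]
    | succ i ih =>
      have h1 := (key C i j).2
      have h2 := (key B.config i j).2
      rw [hC, ih] at h1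
      rw [B.entry_config] at h2
      exact inj _ _ (by omega)
  ext i k
  · rw [hr]
  · rw [hu]

/-! ### The local weights -/

/-- The local weight at position `(i, j)`. Here `i` and `j` run from `0` to `n - 1`, so that the
index `i + j - n - 1` for positions counted from `1` becomes `i + j + 1 - n`. -/
def weight {F : Type*} [Field F] {n : ℕ} (A : Matrix (Fin n) (Fin n) F) (B : ASM n)
    (lam mu : ℤ → F) (i j : Fin n) : F :=
  A i j ^ B.1 i j *
    match B.config.vertex i j with
    | .a₁ => lam ((j : ℤ) - i)
    | .b₁ => mu ((i : ℤ) + j + 1 - n)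
    | .c₂ => lam ((j : ℤ) - i) + mu ((i : ℤ) + j + 1 - n)
    | _ => 1

/-! ### The generic matrix -/

/-- The field of rational functions over `F` in `n ^ 2` indeterminates. -/
abbrev GenericField (F : Type*) [Field F] (n : ℕ) : Type _ :=
  FractionRing (MvPolynomial (Fin n × Fin n) F)

/-- The `n × n` matrix whose entries are the indeterminates. -/
noncomputable def genericMatrix (F : Type*) [Field F] (n : ℕ) :
    Matrix (Fin n) (Fin n) (GenericField F n) :=
  (Matrix.mvPolynomialX (Fin n) (Fin n) F).map (algebraMap _ (GenericField F n))

/-- A sequence of parameters in `F`, viewed in the field of rational functions. -/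
noncomputable def constParam {F : Type*} [Field F] (n : ℕ) (f : ℤ → F) : ℤ → GenericField F n :=
  fun a => algebraMap F (GenericField F n) (f a)

end LambdaDet

/-! An alternating sign matrix is encoded by its corner sums, a height function, whose mixed
differences are the entries. The expansion over ASMs and the determinant are the two ends of a chain
of generating functions `pairSum` over compatible pairs (H, K) of height functions of consecutive
orders: the entries of H are exponents of an array X, those of K are inverse exponents of an array
W, and each cell carries powers of λ and μ.

At the ASM end, X is the matrix and W = 1. Given H, the values of K can be chosen independently in
the cells. The choice is forced except at an entry -1, where the two options contribute λ and μ;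
this is the weight λ + μ of a `c₂` vertex (`sum_weight_eq_pairSum`). At the other end there is a
single pair, of orders 1 and 0, and its weight is the determinant (`pairSum_zero`).

One condensation step (`pairSum_step`) replaces (X, W) by (T, X restricted to its interior) and
lowers the orders. Both sums are organized by the height function K they share: on the left it is
the smaller member of the pair, on the right the larger one. For fixed K both inner sums factor over
cells, after summation by parts (`prod_zpow_mixedDiff`) has turned the powers of X into powers of
its cross ratios r. The recursion reads T W = X(i+1,j) X(i,j+1) (λ + μ r), and the claim becomes
`local_identity`: the two choices above an entry 1 of K give λ + μ r, the two choices below an entry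
-1 give the same sum, and an entry 0 leaves no choice.

Summation by parts divides by entries of X that may vanish. Such entries are replaced by an
indeterminate, which is then set to 0; this is harmless because the exponent -1 occurs only away
from the border, where condensability makes the entries nonzero.

For the generic matrix, the expansion times the product of all entries is a polynomial in which
distinct ASMs give distinct monomials. The identity matrix has a product of values of μ as its
coefficient, so the polynomial is nonzero, and by induction on the order no denominator vanishes. -/

namespace LambdaDet

/-! ### Height functions -/

/-- The mixed second difference of a function on the quadrant. -/
def mixedDiff (H : ℕ → ℕ → ℤ) (i j : ℕ) : ℤ :=
  H (i + 1) (j + 1) + H i j - H (i + 1) j - H i (j + 1)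

/-- Height functions of order `n`: the corner sums of `n × n` alternating sign matrices, continued
to the whole quadrant. -/
structure IsHeight (n : ℕ) (H : ℕ → ℕ → ℤ) : Prop where
  top : ∀ j, H 0 j = 0
  left : ∀ i, H i 0 = 0
  bottom : ∀ i j, n ≤ i → H i j = min (j : ℤ) n
  right : ∀ i j, n ≤ j → H i j = min (i : ℤ) n
  le_down : ∀ i j, H i j ≤ H (i + 1) j
  down_le : ∀ i j, H (i + 1) j ≤ H i j + 1
  le_across : ∀ i j, H i j ≤ H i (j + 1)
  across_le : ∀ i j, H i (j + 1) ≤ H i j + 1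

/-- The type of height functions of order `n`. -/
abbrev Height (n : ℕ) : Type := {H : ℕ → ℕ → ℤ // IsHeight n H}

theorem IsHeight.mixedDiff_eq_zero_of_le_left {n : ℕ} {H : ℕ → ℕ → ℤ} (hH : IsHeight n H)
    {i : ℕ} (j : ℕ) (hi : n ≤ i) : mixedDiff H i j = 0 := by
  simp only [mixedDiff, hH.bottom i _ hi, hH.bottom (i + 1) _ (by omega)]
  ring

theorem IsHeight.mixedDiff_eq_zero_of_le_right {n : ℕ} {H : ℕ → ℕ → ℤ} (hH : IsHeight n H)
    (i : ℕ) {j : ℕ} (hj : n ≤ j) : mixedDiff H i j = 0 := by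
  simp only [mixedDiff, hH.right _ j hj, hH.right _ (j + 1) (by omega)]
  ring

/-! ### Alternating sign matrices and height functions -/

/-- The continuation of a square matrix by a default value. -/
def extend {R : Type*} {n : ℕ} (d : R) (A : Matrix (Fin n) (Fin n) R) (i j : ℕ) : R :=
  if h : i < n ∧ j < n then A ⟨i, h.1⟩ ⟨j, h.2⟩ else d

@[simp]
theorem extend_val {R : Type*} {n : ℕ} (d : R) (A : Matrix (Fin n) (Fin n) R) (i j : Fin n) :
    extend d A i j = A i j := by
  simp [extend]

theorem extend_of_lt {R : Type*} {n : ℕ} (d : R) (A : Matrix (Fin n) (Fin n) R) {i j : ℕ}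
    (hi : i < n) (hj : j < n) : extend d A i j = A ⟨i, hi⟩ ⟨j, hj⟩ := by
  simp [extend, hi, hj]

/-- The corner sums of a matrix. -/
def cornerSum {n : ℕ} (B : Matrix (Fin n) (Fin n) ℤ) (i j : ℕ) : ℤ :=
  ∑ p ∈ Finset.range i, ∑ q ∈ Finset.range j, extend 0 B p q

theorem cornerSum_comm {n : ℕ} (B : Matrix (Fin n) (Fin n) ℤ) (i j : ℕ) :
    cornerSum B i j = cornerSum B.transpose j i := by
  rw [cornerSum, Finset.sum_comm]
  simp [cornerSum, extend, and_comm]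

theorem sum_range_extend {n : ℕ} (B : Matrix (Fin n) (Fin n) ℤ) (i : Fin n) (k : ℕ) :
    ∑ q ∈ Finset.range k, extend 0 B i q = rowSum B i (min k n) := by
  have h : ∀ q : Fin n, (if (q : ℕ) < min k n then B i q else 0) =
      (fun q : ℕ => if q < k then extend 0 B i q else 0) q := by
    intro q
    simp
  rw [rowSum, Finset.sum_congr rfl fun q _ => h q, Fin.sum_univ_eq_sum_range
    (fun q : ℕ => if q < k then extend 0 B i q else 0) n, ← Finset.sum_filter]
  refine (Finset.sum_subset ?_ ?_).symm
  · intro q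
    simp
  · intro q hq hq'
    simp only [Finset.mem_range, Finset.mem_filter, not_and] at hq hq'
    rw [extend, dif_neg]
    exact fun h => hq' h.2 hq

theorem cornerSum_succ_left {n : ℕ} (B : Matrix (Fin n) (Fin n) ℤ) (i : Fin n) (j : ℕ) :
    cornerSum B (i + 1) j = cornerSum B i j + rowSum B i (min j n) := by
  rw [cornerSum, Finset.sum_range_succ, sum_range_extend, cornerSum]

theorem cornerSum_succ_left_of_le {n : ℕ} (B : Matrix (Fin n) (Fin n) ℤ) {i : ℕ} (hi : n ≤ i)
    (j : ℕ) : cornerSum B (i + 1) j = cornerSum B i j := by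
  rw [cornerSum, Finset.sum_range_succ, cornerSum, add_eq_left]
  refine Finset.sum_eq_zero fun q _ => ?_
  rw [extend, dif_neg]
  omega

theorem mixedDiff_cornerSum {n : ℕ} (B : Matrix (Fin n) (Fin n) ℤ) (i j : ℕ) :
    mixedDiff (cornerSum B) i j = extend 0 B i j := by
  simp only [mixedDiff, cornerSum, Finset.sum_range_succ, Finset.sum_add_distrib]
  ring

theorem IsASM.transpose {n : ℕ} {B : Matrix (Fin n) (Fin n) ℤ} (hB : IsASM B) :
    IsASM B.transpose where
  entry i j := hB.entry j i
  row_partial := hB.col_partial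
  col_partial := hB.row_partial
  row_total := hB.col_total
  col_total := hB.row_total

theorem IsASM.cornerSum_step {n : ℕ} {B : Matrix (Fin n) (Fin n) ℤ} (hB : IsASM B) (i j : ℕ) :
    cornerSum B i j ≤ cornerSum B (i + 1) j ∧ cornerSum B (i + 1) j ≤ cornerSum B i j + 1 := by
  by_cases hi : i < n
  · have := cornerSum_succ_left B ⟨i, hi⟩ j
    have h := hB.row_partial ⟨i, hi⟩ (min j n) (min_le_right _ _)
    simp only at this
    omega
  · rw [cornerSum_succ_left_of_le B (not_lt.1 hi)]
    omega

theorem IsASM.cornerSum_bottom {n : ℕ} {B : Matrix (Fin n) (Fin n) ℤ} (hB : IsASM B) (i j : ℕ)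
    (hi : n ≤ i) : cornerSum B i j = min (j : ℤ) n := by
  induction j with
  | zero => simp [cornerSum]
  | succ j ih =>
    rw [cornerSum_comm] at ih ⊢
    by_cases hj : j < n
    · have := cornerSum_succ_left B.transpose ⟨j, hj⟩ i
      rw [min_eq_right hi, hB.transpose.rowSum_last] at this
      simp only at this
      push_cast
      omega
    · rw [cornerSum_succ_left_of_le _ (not_lt.1 hj)]
      push_cast
      omega

theorem IsASM.isHeight {n : ℕ} {B : Matrix (Fin n) (Fin n) ℤ} (hB : IsASM B) :
    IsHeight n (cornerSum B) where
  top j := by simp [cornerSum]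
  left i := by simp [cornerSum]
  bottom := hB.cornerSum_bottom
  right i j hj := by rw [cornerSum_comm, hB.transpose.cornerSum_bottom j i hj]
  le_down i j := (hB.cornerSum_step i j).1
  down_le i j := (hB.cornerSum_step i j).2
  le_across i j := by
    rw [cornerSum_comm, cornerSum_comm B i]; exact (hB.transpose.cornerSum_step j i).1
  across_le i j := by
    rw [cornerSum_comm, cornerSum_comm B i]; exact (hB.transpose.cornerSum_step j i).2

/-- The matrix of mixed differences. -/
def diffMatrix (n : ℕ) (H : ℕ → ℕ → ℤ) : Matrix (Fin n) (Fin n) ℤ :=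
  fun i j => mixedDiff H i j

/-- A function vanishing on both axes is determined by its mixed differences, and those of a height
function are zero outside the `n × n` square. -/
theorem IsHeight.cornerSum_diffMatrix {n : ℕ} {H : ℕ → ℕ → ℤ} (hH : IsHeight n H) :
    cornerSum (diffMatrix n H) = H := by
  have h : ∀ i j, extend 0 (diffMatrix n H) i j = mixedDiff H i j := by
    intro i j
    rw [extend]
    split_ifs with h
    · rfl
    · by_cases hi : i < n
      · rw [hH.mixedDiff_eq_zero_of_le_right]; omega
      · rw [hH.mixedDiff_eq_zero_of_le_left]; omega
  have h' : ∀ i j, mixedDiff (cornerSum (diffMatrix n H)) i j = mixedDiff H i j := by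
    intro i j
    rw [mixedDiff_cornerSum, h]
  ext i j
  induction i generalizing j with
  | zero => simp [cornerSum, hH.top]
  | succ i ih =>
    induction j with
    | zero => simp [cornerSum, hH.left]
    | succ j ihj =>
      have := h' i j
      simp only [mixedDiff, ih, ihj] at this
      linarith

theorem IsHeight.transpose {n : ℕ} {H : ℕ → ℕ → ℤ} (hH : IsHeight n H) :
    IsHeight n (fun i j => H j i) where
  top := hH.left
  left := hH.top
  bottom i j := hH.right j i
  right i j := hH.bottom j i
  le_down i j := hH.le_across j i
  down_le i j := hH.across_le j i
  le_across i j := hH.le_down j i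
  across_le i j := hH.down_le j i

theorem IsHeight.rowSum_diffMatrix {n : ℕ} {H : ℕ → ℕ → ℤ} (hH : IsHeight n H) (i : Fin n)
    {k : ℕ} (hk : k ≤ n) : rowSum (diffMatrix n H) i k = H (i + 1) k - H i k := by
  have := cornerSum_succ_left (diffMatrix n H) i k
  rw [hH.cornerSum_diffMatrix, min_eq_left hk] at this
  linarith

theorem IsHeight.colSum_diffMatrix {n : ℕ} {H : ℕ → ℕ → ℤ} (hH : IsHeight n H) (j : Fin n)
    {k : ℕ} (hk : k ≤ n) : colSum (diffMatrix n H) k j = H k (j + 1) - H k j := by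
  rw [← hH.transpose.rowSum_diffMatrix j hk]
  refine Finset.sum_congr rfl fun p _ => ?_
  simp only [diffMatrix, mixedDiff]
  split_ifs <;> ring

theorem IsHeight.isASM {n : ℕ} {H : ℕ → ℕ → ℤ} (hH : IsHeight n H) :
    IsASM (diffMatrix n H) where
  entry i j := by
    have h1 := hH.le_down i j
    have h2 := hH.down_le i j
    have h3 := hH.le_down i (j + 1)
    have h4 := hH.down_le i (j + 1)
    simp only [diffMatrix, mixedDiff]
    omega
  row_partial i k hk := by
    rw [hH.rowSum_diffMatrix i hk]
    have h1 := hH.le_down i k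
    have h2 := hH.down_le i k
    omega
  col_partial j k hk := by
    rw [hH.colSum_diffMatrix j hk]
    have h1 := hH.le_across k j
    have h2 := hH.across_le k j
    omega
  row_total i := by
    have := hH.rowSum_diffMatrix i le_rfl
    rw [hH.right _ _ le_rfl, hH.right _ _ le_rfl] at this
    simp only [rowSum, Fin.is_lt, if_true] at this
    rw [this]
    push_cast
    omega
  col_total j := by
    have := hH.colSum_diffMatrix j le_rfl
    rw [hH.bottom _ _ le_rfl, hH.bottom _ _ le_rfl] at this
    simp only [colSum, Fin.is_lt, if_true] at this
    rw [this]
    push_cast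
    omega

/-- Alternating sign matrices correspond to height functions. -/
def heightEquiv (n : ℕ) : Height n ≃ ASM n where
  toFun H := ⟨diffMatrix n H.1, H.2.isASM⟩
  invFun B := ⟨cornerSum B.1, B.2.isHeight⟩
  left_inv H := Subtype.ext H.2.cornerSum_diffMatrix
  right_inv B := Subtype.ext <| by
    ext i j
    simp [diffMatrix, mixedDiff_cornerSum]

instance (n : ℕ) : Finite (Height n) := Finite.of_equiv _ (heightEquiv n).symm

noncomputable instance (n : ℕ) : Fintype (Height n) := Fintype.ofFinite _

/-! ### Compatible pairs of height functions -/

/-- Compatibility of a height function `H` of order `n` with a height function `K` of order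
`n - 1`. -/
def Compatible (n : ℕ) (H K : ℕ → ℕ → ℤ) : Prop :=
  ∀ i < n, ∀ j < n, H i j ≤ K i j ∧ H (i + 1) (j + 1) - 1 ≤ K i j ∧
    K i j ≤ H (i + 1) j ∧ K i j ≤ H i (j + 1)

/-- The values that a height function of lower order compatible with `H` may take at `(i, j)`. -/
noncomputable def lowerRange (H : ℕ → ℕ → ℤ) (i j : ℕ) : Finset ℤ :=
  Finset.Icc (max (H i j) (H (i + 1) (j + 1) - 1)) (min (H (i + 1) j) (H i (j + 1)))

/-- The values that a height function of higher order compatible with `K` may take at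
`(i + 1, j + 1)`. -/
noncomputable def upperRange (K : ℕ → ℕ → ℤ) (i j : ℕ) : Finset ℤ :=
  Finset.Icc (max (K i (j + 1)) (K (i + 1) j)) (min (K i j + 1) (K (i + 1) (j + 1)))

theorem Compatible.mem_lowerRange {n : ℕ} {H K : ℕ → ℕ → ℤ} (h : Compatible n H K) {i j : ℕ}
    (hi : i < n) (hj : j < n) : K i j ∈ lowerRange H i j := by
  have := h i hi j hj
  simp only [lowerRange, Finset.mem_Icc]
  omega

theorem Compatible.mem_upperRange {m : ℕ} {H K : ℕ → ℕ → ℤ} (h : Compatible (m + 1) H K) {i j : ℕ}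
    (hi : i < m) (hj : j < m) : H (i + 1) (j + 1) ∈ upperRange K i j := by
  have h1 := h i (by omega) j (by omega)
  have h2 := h i (by omega) (j + 1) (by omega)
  have h3 := h (i + 1) (by omega) j (by omega)
  have h4 := h (i + 1) (by omega) (j + 1) (by omega)
  simp only [upperRange, Finset.mem_Icc]
  omega

/-- The height function of order `m` with given values. -/
def lowerHeight (m : ℕ) (p : ℕ → ℕ → ℤ) (i j : ℕ) : ℤ := p (min i m) (min j m)

/-- The conditions on different cells are independent: `H` separates neighbouring values, as in
p(i,j) ≤ H(i+1,j) ≤ p(i+1,j) ≤ H(i+1,j+1) ≤ p(i,j) + 1, and on the border the ranges shrink to the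
prescribed boundary value. -/
theorem isHeight_lowerHeight {m : ℕ} {H : ℕ → ℕ → ℤ} (hH : IsHeight (m + 1) H) {p : ℕ → ℕ → ℤ}
    (hp : ∀ i ≤ m, ∀ j ≤ m, p i j ∈ lowerRange H i j) : IsHeight m (lowerHeight m p) := by
  simp only [lowerRange, Finset.mem_Icc] at hp
  constructor
  · intro j
    have h := hp 0 (by omega) (min j m) (by omega)
    have h1 := hH.top (min j m)
    have h2 := hH.top (min j m + 1)
    simp only [lowerHeight, Nat.zero_min]
    omega
  · intro i
    have h := hp (min i m) (by omega) 0 (by omega)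
    have h1 := hH.left (min i m)
    have h2 := hH.left (min i m + 1)
    simp only [lowerHeight, Nat.zero_min]
    omega
  · intro i j hi
    have h := hp m (by omega) (min j m) (by omega)
    have h1 := hH.bottom (m + 1) (min j m) (by omega)
    have h2 := hH.bottom (m + 1) (min j m + 1) (by omega)
    simp only [lowerHeight, min_eq_right hi]
    push_cast at *
    omega
  · intro i j hj
    have h := hp (min i m) (by omega) m (by omega)
    have h1 := hH.right (min i m) (m + 1) (by omega)
    have h2 := hH.right (min i m + 1) (m + 1) (by omega)
    simp only [lowerHeight, min_eq_right hj]
    push_cast at *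
    omega
  all_goals
    intro i j
    simp only [lowerHeight]
  · by_cases hi : i < m
    · rw [min_eq_left hi.le, min_eq_left (a := i + 1) (by omega)]
      have h1 := hp i (by omega) (min j m) (by omega)
      have h2 := hp (i + 1) (by omega) (min j m) (by omega)
      omega
    · rw [min_eq_right (a := i) (by omega), min_eq_right (a := i + 1) (by omega)]
  · by_cases hi : i < m
    · rw [min_eq_left hi.le, min_eq_left (a := i + 1) (by omega)]
      have h1 := hp i (by omega) (min j m) (by omega)
      have h2 := hp (i + 1) (by omega) (min j m) (by omega)
      omega
    · rw [min_eq_right (a := i) (by omega), min_eq_right (a := i + 1) (by omega)]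
      omega
  · by_cases hj : j < m
    · rw [min_eq_left hj.le, min_eq_left (a := j + 1) (by omega)]
      have h1 := hp (min i m) (by omega) j (by omega)
      have h2 := hp (min i m) (by omega) (j + 1) (by omega)
      omega
    · rw [min_eq_right (a := j) (by omega), min_eq_right (a := j + 1) (by omega)]
  · by_cases hj : j < m
    · rw [min_eq_left hj.le, min_eq_left (a := j + 1) (by omega)]
      have h1 := hp (min i m) (by omega) j (by omega)
      have h2 := hp (min i m) (by omega) (j + 1) (by omega)
      omega
    · rw [min_eq_right (a := j) (by omega), min_eq_right (a := j + 1) (by omega)]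
      omega

/-- The height function of order `m + 1` with given values at the interior points. -/
def upperHeight (m : ℕ) (p : ℕ → ℕ → ℤ) : ℕ → ℕ → ℤ
  | 0, _ => 0
  | _ + 1, 0 => 0
  | i + 1, j + 1 => if i < m then if j < m then p i j else i + 1 else min (j + 1) (m + 1)

theorem upperHeight_of_lt {m : ℕ} (p : ℕ → ℕ → ℤ) {i j : ℕ} (hi : i < m) (hj : j < m) :
    upperHeight m p (i + 1) (j + 1) = p i j := by
  simp [upperHeight, hi, hj]

theorem upperHeight_of_le_left {m : ℕ} (p : ℕ → ℕ → ℤ) {i : ℕ} (j : ℕ) (hi : m ≤ i) :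
    upperHeight m p (i + 1) (j + 1) = min ((j : ℤ) + 1) (m + 1) := by
  simp [upperHeight, hi.not_gt]

theorem upperHeight_of_le_right {m : ℕ} (p : ℕ → ℕ → ℤ) (i : ℕ) {j : ℕ} (hj : m ≤ j) :
    upperHeight m p (i + 1) (j + 1) = min ((i : ℤ) + 1) (m + 1) := by
  simp only [upperHeight, hj.not_gt, if_false]
  split_ifs <;> omega

/-- Values of `K` separate vertically adjacent choices: p(i,j) ≤ K(i+1,j+1) ≤ p(i+1,j) ≤ K(i+1,j) +
1 ≤ p(i,j) + 1. The horizontal steps follow by transposition. -/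
theorem upperHeight_step_left {m : ℕ} {K : ℕ → ℕ → ℤ} (hK : IsHeight m K) {p : ℕ → ℕ → ℤ}
    (hp : ∀ i < m, ∀ j < m, p i j ∈ upperRange K i j) (i j : ℕ) :
    upperHeight m p i j ≤ upperHeight m p (i + 1) j ∧
      upperHeight m p (i + 1) j ≤ upperHeight m p i j + 1 := by
  simp only [upperRange, Finset.mem_Icc] at hp
  rcases i with _ | i <;> rcases j with _ | j
  · simp [upperHeight]
  · rw [show upperHeight m p 0 (j + 1) = 0 from rfl]
    rcases lt_or_ge 0 m with h1 | h1 <;> rcases lt_or_ge j m with h2 | h2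
    · rw [upperHeight_of_lt p h1 h2]
      have h3 := hp 0 h1 j h2
      have h4 := hK.top j
      have h5 := hK.top (j + 1)
      omega
    · rw [upperHeight_of_le_right p _ h2]; omega
    · omega
    · rw [upperHeight_of_le_right p _ h2]; omega
  · simp [upperHeight]
  · rcases lt_or_ge j m with h2 | h2
    · rcases lt_or_ge (i + 1) m with h1 | h1
      · rw [upperHeight_of_lt p (by omega) h2, upperHeight_of_lt p h1 h2]
        have h3 := hp i (by omega) j h2
        have h4 := hp (i + 1) h1 j h2
        omega
      · rw [upperHeight_of_le_left p _ h1]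
        rcases lt_or_ge i m with h3 | h3
        · rw [upperHeight_of_lt p h3 h2]
          have h4 := hp i h3 j h2
          have h5 := hK.bottom (i + 1) j h1
          have h6 := hK.bottom (i + 1) (j + 1) h1
          push_cast at h6
          omega
        · rw [upperHeight_of_le_left p _ h3]; omega
    · rw [upperHeight_of_le_right p _ h2, upperHeight_of_le_right p _ h2]
      push_cast
      omega

theorem transpose_mem_upperRange {K : ℕ → ℕ → ℤ} {i j : ℕ} {k : ℤ} (h : k ∈ upperRange K j i) :
    k ∈ upperRange (fun i j => K j i) i j := by
  simpa [upperRange, and_comm] using h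

theorem upperHeight_transpose (m : ℕ) (p : ℕ → ℕ → ℤ) (i j : ℕ) :
    upperHeight m p i j = upperHeight m (fun i j => p j i) j i := by
  rcases i with _ | i <;> rcases j with _ | j
  · rfl
  · rfl
  · rfl
  · rcases lt_or_ge i m with h1 | h1
    · rcases lt_or_ge j m with h2 | h2
      · rw [upperHeight_of_lt p h1 h2, upperHeight_of_lt _ h2 h1]
      · rw [upperHeight_of_le_right p _ h2, upperHeight_of_le_left _ _ h2]
    · rw [upperHeight_of_le_left p _ h1, upperHeight_of_le_right _ _ h1]

theorem isHeight_upperHeight {m : ℕ} {K : ℕ → ℕ → ℤ} (hK : IsHeight m K) {p : ℕ → ℕ → ℤ}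
    (hp : ∀ i < m, ∀ j < m, p i j ∈ upperRange K i j) : IsHeight (m + 1) (upperHeight m p) := by
  have hp' : ∀ i < m, ∀ j < m, p j i ∈ upperRange (fun i j => K j i) i j :=
    fun i hi j hj => transpose_mem_upperRange (hp j hj i hi)
  refine ⟨fun j => rfl, ?_, ?_, ?_, fun i j => (upperHeight_step_left hK hp i j).1,
    fun i j => (upperHeight_step_left hK hp i j).2, ?_, ?_⟩
  · rintro (_ | i) <;> rfl
  · rintro (_ | i) (_ | j) hi
    · omega
    · omega
    · simp only [upperHeight]; omega
    · rw [upperHeight_of_le_left p _ (by omega)]; push_cast; rfl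
  · rintro (_ | i) (_ | j) hj
    · omega
    · simp only [upperHeight]; omega
    · omega
    · rw [upperHeight_of_le_right p _ (by omega)]; push_cast; rfl
  · intro i j
    rw [upperHeight_transpose, upperHeight_transpose m p i]
    exact (upperHeight_step_left hK.transpose hp' j i).1
  · intro i j
    rw [upperHeight_transpose, upperHeight_transpose m p i]
    exact (upperHeight_step_left hK.transpose hp' j i).2

theorem compatible_lowerHeight {m : ℕ} {H : ℕ → ℕ → ℤ} {p : ℕ → ℕ → ℤ}
    (hp : ∀ i ≤ m, ∀ j ≤ m, p i j ∈ lowerRange H i j) :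
    Compatible (m + 1) H (lowerHeight m p) := by
  intro i hi j hj
  have h := hp i (by omega) j (by omega)
  simp only [lowerRange, Finset.mem_Icc] at h
  rw [lowerHeight, min_eq_left (by omega), min_eq_left (by omega)]
  omega

theorem compatible_upperHeight {m : ℕ} {K : ℕ → ℕ → ℤ} (hK : IsHeight m K) {p : ℕ → ℕ → ℤ}
    (hp : ∀ i < m, ∀ j < m, p i j ∈ upperRange K i j) :
    Compatible (m + 1) (upperHeight m p) K := by
  have hH := isHeight_upperHeight hK hp
  have hval : ∀ i < m, ∀ j < m, upperHeight m p (i + 1) (j + 1) = p i j :=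
    fun i hi j hj => upperHeight_of_lt p hi hj
  simp only [upperRange, Finset.mem_Icc] at hp
  intro i hi j hj
  refine ⟨?_, ?_, ?_, ?_⟩
  · rcases i with _ | i
    · rw [hH.top, hK.top]
    rcases j with _ | j
    · rw [hH.left, hK.left]
    rw [hval i (by omega) j (by omega)]
    have := hp i (by omega) j (by omega)
    omega
  · by_cases hi' : i < m
    · by_cases hj' : j < m
      · rw [hval i hi' j hj']
        have := hp i hi' j hj'
        omega
      · obtain rfl : j = m := by omega
        rw [hH.right _ _ le_rfl, hK.right _ _ le_rfl]
        push_cast; omega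
    · obtain rfl : i = m := by omega
      rw [hH.bottom _ _ le_rfl, hK.bottom _ _ le_rfl]
      push_cast; omega
  · rcases j with _ | j
    · rw [hH.left, hK.left]
    by_cases hi' : i < m
    · rw [hval i hi' j (by omega)]
      have := hp i hi' j (by omega)
      omega
    · obtain rfl : i = m := by omega
      rw [hH.bottom _ _ le_rfl, hK.bottom _ _ le_rfl]
      push_cast; omega
  · rcases i with _ | i
    · rw [hH.top, hK.top]
    by_cases hj' : j < m
    · rw [hval i (by omega) j hj']
      have := hp i (by omega) j hj'
      omega
    · obtain rfl : j = m := by omega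
      rw [hH.right _ _ le_rfl, hK.right _ _ le_rfl]
      push_cast; omega

/-! ### Summation over the height functions compatible with a given one -/

theorem prod_range_range_eq {R : Type*} [CommMonoid R] (n : ℕ) (f : ℕ → ℕ → R) :
    ∏ i ∈ Finset.range n, ∏ j ∈ Finset.range n, f i j = ∏ x : Fin n × Fin n, f x.1 x.2 := by
  rw [Fintype.prod_prod_type, ← Fin.prod_univ_eq_prod_range]
  refine Finset.prod_congr rfl fun i _ => ?_
  rw [← Fin.prod_univ_eq_prod_range]

-- Expanding the product of sums gives a sum over choice functions, and these are exactly the height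
-- functions compatible with `H`.
open Classical in
theorem sum_compatible_lower {R : Type*} [CommRing R] {m : ℕ} (H : Height (m + 1))
    (f : ℕ → ℕ → ℤ → R) :
    ∑ K : Height m, (if Compatible (m + 1) H.1 K.1 then
        ∏ i ∈ Finset.range (m + 1), ∏ j ∈ Finset.range (m + 1), f i j (K.1 i j) else 0) =
      ∏ i ∈ Finset.range (m + 1), ∏ j ∈ Finset.range (m + 1),
        ∑ k ∈ lowerRange H.1 i j, f i j k := by
  rw [prod_range_range_eq (m + 1) (fun i j => ∑ k ∈ lowerRange H.1 i j, f i j k),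
    Finset.prod_univ_sum, ← Finset.sum_filter]
  have hmem : ∀ p ∈ Fintype.piFinset
      (fun x : Fin (m + 1) × Fin (m + 1) => lowerRange H.1 x.1 x.2), ∀ i ≤ m, ∀ j ≤ m,
      extend 0 (Matrix.of fun a b => p (a, b)) i j ∈ lowerRange H.1 i j := by
    intro p hp i hi j hj
    rw [extend_of_lt _ _ (by omega) (by omega)]
    exact Fintype.mem_piFinset.1 hp (⟨i, by omega⟩, ⟨j, by omega⟩)
  refine Finset.sum_bij' (fun K _ x => K.1 x.1 x.2)
    (fun p hp => ⟨lowerHeight m (extend 0 (Matrix.of fun a b => p (a, b))),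
      isHeight_lowerHeight H.2 (hmem p hp)⟩) ?_ ?_ ?_ ?_ ?_
  · intro K hK
    rw [Finset.mem_filter] at hK
    exact Fintype.mem_piFinset.2 fun x => hK.2.mem_lowerRange x.1.2 x.2.2
  · intro p hp
    rw [Finset.mem_filter]
    exact ⟨Finset.mem_univ _, compatible_lowerHeight (hmem p hp)⟩
  · intro K hK
    refine Subtype.ext ?_
    ext i j
    simp only [lowerHeight]
    rw [extend_of_lt _ _ (by omega) (by omega)]
    simp only [Matrix.of_apply]
    rcases le_total i m with hi | hi <;> rcases le_total j m with hj | hj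
    · simp [hi, hj]
    · simp only [min_eq_left hi, min_eq_right hj, K.2.right _ _ hj, K.2.right _ _ le_rfl]
    · simp only [min_eq_left hj, min_eq_right hi, K.2.bottom _ _ hi, K.2.bottom _ _ le_rfl]
    · simp only [min_eq_right hj, min_eq_right hi, K.2.bottom _ _ hi, K.2.bottom _ _ le_rfl]
      omega
  · intro p hp
    ext x
    have h1 := x.1.2
    have h2 := x.2.2
    simp only [lowerHeight]
    rw [min_eq_left (by omega), min_eq_left (by omega), extend_val]
    rfl
  · intro K hK
    rw [prod_range_range_eq (m + 1) (fun i j => f i j (K.1 i j))]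

-- Only the `m × m` interior values of the larger height function are free, since its border is
-- forced; hence the smaller range of the product.
open Classical in
theorem sum_compatible_upper {R : Type*} [CommRing R] {m : ℕ} (K : Height m)
    (f : ℕ → ℕ → ℤ → R) :
    ∑ H : Height (m + 1), (if Compatible (m + 1) H.1 K.1 then
        ∏ i ∈ Finset.range m, ∏ j ∈ Finset.range m, f i j (H.1 (i + 1) (j + 1)) else 0) =
      ∏ i ∈ Finset.range m, ∏ j ∈ Finset.range m, ∑ k ∈ upperRange K.1 i j, f i j k := by
  rw [prod_range_range_eq m (fun i j => ∑ k ∈ upperRange K.1 i j, f i j k),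
    Finset.prod_univ_sum, ← Finset.sum_filter]
  have hmem : ∀ p ∈ Fintype.piFinset
      (fun x : Fin m × Fin m => upperRange K.1 x.1 x.2), ∀ i < m, ∀ j < m,
      extend 0 (Matrix.of fun a b => p (a, b)) i j ∈ upperRange K.1 i j := by
    intro p hp i hi j hj
    rw [extend_of_lt _ _ (by omega) (by omega)]
    exact Fintype.mem_piFinset.1 hp (⟨i, by omega⟩, ⟨j, by omega⟩)
  refine Finset.sum_bij' (fun H _ x => H.1 (x.1 + 1) (x.2 + 1))
    (fun p hp => ⟨upperHeight m (extend 0 (Matrix.of fun a b => p (a, b))),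
      isHeight_upperHeight K.2 (hmem p hp)⟩) ?_ ?_ ?_ ?_ ?_
  · intro H hH
    rw [Finset.mem_filter] at hH
    exact Fintype.mem_piFinset.2 fun x => hH.2.mem_upperRange x.1.2 x.2.2
  · intro p hp
    rw [Finset.mem_filter]
    exact ⟨Finset.mem_univ _, compatible_upperHeight K.2 (hmem p hp)⟩
  · intro H hH
    refine Subtype.ext ?_
    ext i j
    rcases i with _ | i
    · simp [upperHeight, H.2.top]
    rcases j with _ | j
    · simp [upperHeight, H.2.left]
    simp only [upperHeight]
    split_ifs with h1 h2
    · rw [extend_of_lt _ _ h1 h2]; rfl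
    · rw [H.2.right _ _ (by omega)]; push_cast; omega
    · rw [H.2.bottom _ _ (by omega)]; push_cast; omega
  · intro p hp
    ext x
    simp [upperHeight, x.1.2, x.2.2]
  · intro H hH
    rw [prod_range_range_eq m (fun i j => f i j (H.1 (i + 1) (j + 1)))]

/-! ### Summation by parts -/

section Abel

variable {F : Type*} [Field F]

/-- The cross ratio of four neighbouring entries. -/
def cross (X : ℕ → ℕ → F) (i j : ℕ) : F :=
  X i j * X (i + 1) (j + 1) / (X (i + 1) j * X i (j + 1))

theorem prod_range_zpow_sub (n : ℕ) (t : ℕ → F) (ht : ∀ j < n + 1, t j ≠ 0) (g : ℕ → ℤ)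
    (h0 : g 0 = 0) (hn : g (n + 1) = 0) :
    ∏ j ∈ Finset.range (n + 1), t j ^ (g (j + 1) - g j) =
      ∏ j ∈ Finset.range n, (t j / t (j + 1)) ^ g (j + 1) := by
  have h : ∀ j ∈ Finset.range (n + 1), t j ^ (g (j + 1) - g j) = t j ^ g (j + 1) / t j ^ g j :=
    fun j hj => zpow_sub₀ (ht j (Finset.mem_range.1 hj)) _ _
  rw [Finset.prod_congr rfl h, Finset.prod_div_distrib, Finset.prod_range_succ,
    Finset.prod_range_succ' (fun j => t j ^ g j), h0, hn, zpow_zero, zpow_zero, mul_one, mul_one,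
    ← Finset.prod_div_distrib]
  exact Finset.prod_congr rfl fun j _ => (div_zpow _ _ _).symm

/-- Summation by parts in each of the two directions moves the differences from the exponents to the
bases. The boundary terms vanish with `e`. -/
theorem prod_zpow_mixedDiff (n : ℕ) (X : ℕ → ℕ → F) (hX : ∀ i < n + 1, ∀ j < n + 1, X i j ≠ 0)
    (e : ℕ → ℕ → ℤ) (htop : ∀ j, e 0 j = 0) (hleft : ∀ i, e i 0 = 0)
    (hbottom : ∀ j, e (n + 1) j = 0) (hright : ∀ i, e i (n + 1) = 0) :
    ∏ i ∈ Finset.range (n + 1), ∏ j ∈ Finset.range (n + 1), X i j ^ mixedDiff e i j =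
      ∏ i ∈ Finset.range n, ∏ j ∈ Finset.range n, cross X i j ^ e (i + 1) (j + 1) := by
  have h1 : ∀ i ∈ Finset.range (n + 1), ∏ j ∈ Finset.range (n + 1), X i j ^ mixedDiff e i j =
      ∏ j ∈ Finset.range n, (X i j / X i (j + 1)) ^ (e (i + 1) (j + 1) - e i (j + 1)) := by
    intro i hi
    rw [← prod_range_zpow_sub n (X i) (hX i (Finset.mem_range.1 hi)) (fun j => e (i + 1) j - e i j)
      (by simp [hleft]) (by simp [hright])]
    refine Finset.prod_congr rfl fun j _ => ?_
    congr 1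
    simp only [mixedDiff]
    ring
  rw [Finset.prod_congr rfl h1, Finset.prod_comm]
  conv_rhs => rw [Finset.prod_comm]
  refine Finset.prod_congr rfl fun j hj => ?_
  rw [Finset.mem_range] at hj
  rw [prod_range_zpow_sub n (fun i => X i j / X i (j + 1))
    (fun i hi => div_ne_zero (hX i hi j (by omega)) (hX i hi (j + 1) (by omega)))
    (fun i => e i (j + 1)) (htop _) (hbottom _)]
  refine Finset.prod_congr rfl fun i _ => ?_
  simp only [cross]
  congr 1
  rw [div_div_div_eq, mul_comm (X i (j + 1))]

theorem prod_range_pad {M : Type*} [CommMonoid M] (n : ℕ) (f : ℕ → ℕ → M)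
    (htop : ∀ j, f 0 j = 1) (hleft : ∀ i, f i 0 = 1)
    (hbottom : ∀ j < n + 2, f (n + 1) j = 1) (hright : ∀ i < n + 2, f i (n + 1) = 1) :
    ∏ i ∈ Finset.range (n + 2), ∏ j ∈ Finset.range (n + 2), f i j =
      ∏ i ∈ Finset.range n, ∏ j ∈ Finset.range n, f (i + 1) (j + 1) := by
  rw [Finset.prod_range_succ, Finset.prod_range_succ', Finset.prod_eq_one (fun j _ => htop j),
    Finset.prod_eq_one (fun j hj => hbottom j (Finset.mem_range.1 hj)), mul_one, mul_one]
  refine Finset.prod_congr rfl fun i hi => ?_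
  rw [Finset.mem_range] at hi
  rw [Finset.prod_range_succ, Finset.prod_range_succ', hleft, hright _ (by omega), mul_one, mul_one]

end Abel

/-! ### The sum over compatible pairs -/

section PairSum

variable {F : Type*} [Field F]

/-- The weight of a compatible pair `(H, K)` of height functions of orders `m + 1` and `m`. -/
def pairWeight (m : ℕ) (X W : ℕ → ℕ → F) (lam mu : ℤ → F) (H K : ℕ → ℕ → ℤ) : F :=
  (∏ i ∈ Finset.range (m + 1), ∏ j ∈ Finset.range (m + 1), X i j ^ mixedDiff H i j) *
  (∏ i ∈ Finset.range (m + 1), ∏ j ∈ Finset.range (m + 1),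
    (lam ((j : ℤ) - i) ^ (1 - H (i + 1) (j + 1) + K i j) *
      mu ((i : ℤ) + j - m) ^ (H i (j + 1) - K i j))) *
  ∏ i ∈ Finset.range m, ∏ j ∈ Finset.range m, W i j ^ (-mixedDiff K i j)

open Classical in
/-- The generating function of compatible pairs of height functions of orders `m + 1` and `m`. -/
noncomputable def pairSum (m : ℕ) (X W : ℕ → ℕ → F) (lam mu : ℤ → F) : F :=
  ∑ H : Height (m + 1), ∑ K : Height m,
    if Compatible (m + 1) H.1 K.1 then pairWeight m X W lam mu H.1 K.1 else 0

theorem mixedDiff_sub (H K : ℕ → ℕ → ℤ) (i j : ℕ) :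
    mixedDiff (fun i j => H i j - K i j) i j = mixedDiff H i j - mixedDiff K i j := by
  simp only [mixedDiff]
  ring

/-- Two height functions of the same order agree on the border, so summation by parts applies to
their difference. Relative to a fixed reference, the dependence on `H` becomes a product of factors
each involving one value of `H`, which is what allows summation cell by cell. -/
theorem prod_zpow_mixedDiff_height {m : ℕ} {H K : ℕ → ℕ → ℤ} (hH : IsHeight (m + 1) H)
    (hK : IsHeight (m + 1) K) (X : ℕ → ℕ → F) (hX : ∀ i < m + 1, ∀ j < m + 1, X i j ≠ 0) :
    ∏ i ∈ Finset.range (m + 1), ∏ j ∈ Finset.range (m + 1), X i j ^ mixedDiff H i j =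
      (∏ i ∈ Finset.range (m + 1), ∏ j ∈ Finset.range (m + 1), X i j ^ mixedDiff K i j) *
      ∏ i ∈ Finset.range m, ∏ j ∈ Finset.range m,
        cross X i j ^ (H (i + 1) (j + 1) - K (i + 1) (j + 1)) := by
  rw [← prod_zpow_mixedDiff m X hX (fun i j => H i j - K i j) (by simp [hH.top, hK.top])
    (by simp [hH.left, hK.left]) (by simp [hH.bottom _ _ le_rfl, hK.bottom _ _ le_rfl])
    (by simp [hH.right _ _ le_rfl, hK.right _ _ le_rfl]), ← Finset.prod_mul_distrib]
  refine Finset.prod_congr rfl fun i hi => ?_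
  rw [← Finset.prod_mul_distrib]
  refine Finset.prod_congr rfl fun j hj => ?_
  rw [← zpow_add₀ (hX i (Finset.mem_range.1 hi) j (Finset.mem_range.1 hj)), mixedDiff_sub]
  congr 1
  ring

open Classical in
/-- The sum over the lower height function, for a fixed upper one. -/
theorem sum_pairWeight_lower {m : ℕ} (H : Height (m + 1)) (K₀ : Height m) (X Y : ℕ → ℕ → F)
    (lam mu : ℤ → F) (hY : ∀ i < m, ∀ j < m, Y (i + 1) (j + 1) ≠ 0) :
    ∑ K : Height m, (if Compatible (m + 1) H.1 K.1 then
        pairWeight m X (fun i j => Y (i + 1) (j + 1)) lam mu H.1 K.1 else 0) =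
      (∏ i ∈ Finset.range (m + 1), ∏ j ∈ Finset.range (m + 1), X i j ^ mixedDiff H.1 i j) *
      (∏ i ∈ Finset.range m, ∏ j ∈ Finset.range m,
        Y (i + 1) (j + 1) ^ (-mixedDiff K₀.1 i j)) *
      ∏ i ∈ Finset.range (m + 1), ∏ j ∈ Finset.range (m + 1), ∑ k ∈ lowerRange H.1 i j,
        (lam ((j : ℤ) - i) ^ (1 - H.1 (i + 1) (j + 1) + k) *
          mu ((i : ℤ) + j - m) ^ (H.1 i (j + 1) - k) * cross Y i j ^ (K₀.1 i j - k)) := by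
  rw [← sum_compatible_lower, Finset.mul_sum]
  refine Finset.sum_congr rfl fun K _ => ?_
  rw [mul_ite, mul_zero]
  congr 1
  have key : ∏ i ∈ Finset.range m, ∏ j ∈ Finset.range m, Y (i + 1) (j + 1) ^ (-mixedDiff K.1 i j) =
      (∏ i ∈ Finset.range m, ∏ j ∈ Finset.range m, Y (i + 1) (j + 1) ^ (-mixedDiff K₀.1 i j)) *
      ∏ i ∈ Finset.range (m + 1), ∏ j ∈ Finset.range (m + 1),
        cross Y i j ^ (K₀.1 i j - K.1 i j) := by
    rcases m with _ | m
    · simp [K₀.2.top, K.2.top]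
    -- On border cells `K` and `K₀` agree, so the cross ratio has exponent 0 there and the border
    -- entries of `Y` may vanish.
    · rw [prod_range_pad m _ (by simp [K₀.2.top, K.2.top]) (by simp [K₀.2.left, K.2.left])
        (by simp [K₀.2.bottom _ _ le_rfl, K.2.bottom _ _ le_rfl])
        (by simp [K₀.2.right _ _ le_rfl, K.2.right _ _ le_rfl])]
      simp only [zpow_neg, Finset.prod_inv_distrib]
      rw [prod_zpow_mixedDiff_height K₀.2 K.2 (fun i j => Y (i + 1) (j + 1)) hY, mul_inv,
        mul_assoc]
      symm
      convert mul_one _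
      refine inv_mul_cancel₀ ?_
      refine Finset.prod_ne_zero_iff.2 fun i hi => Finset.prod_ne_zero_iff.2 fun j hj => ?_
      rw [Finset.mem_range] at hi hj
      refine zpow_ne_zero _ (div_ne_zero (mul_ne_zero ?_ ?_) (mul_ne_zero ?_ ?_)) <;>
        apply hY <;> omega
  rw [pairWeight, key]
  simp only [Finset.prod_mul_distrib]
  ring

open Classical in
/-- The sum over the upper height function, for a fixed lower one. -/
theorem sum_pairWeight_upper {m : ℕ} (H₀ : Height (m + 1)) (K : Height m) (X W : ℕ → ℕ → F)
    (lam mu : ℤ → F) (hX : ∀ i < m + 1, ∀ j < m + 1, X i j ≠ 0) :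
    ∑ H : Height (m + 1), (if Compatible (m + 1) H.1 K.1 then
        pairWeight m X W lam mu H.1 K.1 else 0) =
      (∏ i ∈ Finset.range (m + 1), ∏ j ∈ Finset.range (m + 1), X i j ^ mixedDiff H₀.1 i j) *
      (∏ i ∈ Finset.range m, ∏ j ∈ Finset.range m, W i j ^ (-mixedDiff K.1 i j)) *
      ∏ i ∈ Finset.range m, ∏ j ∈ Finset.range m, ∑ k ∈ upperRange K.1 i j,
        (lam ((j : ℤ) - i) ^ (1 - k + K.1 i j) * mu ((i : ℤ) + 1 + j - m) ^ (k - K.1 (i + 1) j) *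
          cross X i j ^ (k - H₀.1 (i + 1) (j + 1))) := by
  rw [← sum_compatible_upper, Finset.mul_sum]
  refine Finset.sum_congr rfl fun H _ => ?_
  rw [mul_ite, mul_zero]
  congr 1
  -- Factors are regrouped by the value H(i+1,j+1): it enters the λ-power of cell (i,j) and the
  -- μ-power of cell (i+1,j). The leftover λ-powers (last row and column) and μ-powers (first row,
  -- last column) have exponent 0 by the boundary values.
  have hlam : ∏ i ∈ Finset.range (m + 1), ∏ j ∈ Finset.range (m + 1),
      lam ((j : ℤ) - i) ^ (1 - H.1 (i + 1) (j + 1) + K.1 i j) =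
      ∏ i ∈ Finset.range m, ∏ j ∈ Finset.range m,
        lam ((j : ℤ) - i) ^ (1 - H.1 (i + 1) (j + 1) + K.1 i j) := by
    rw [Finset.prod_range_succ, Finset.prod_eq_one (s := Finset.range (m + 1)), mul_one]
    · refine Finset.prod_congr rfl fun i hi => ?_
      rw [Finset.prod_range_succ, H.2.right _ _ le_rfl, K.2.right _ _ le_rfl]
      rw [Finset.mem_range] at hi
      convert mul_one _
      convert zpow_zero _
      push_cast
      omega
    · intro j hj
      rw [H.2.bottom _ _ le_rfl, K.2.bottom _ _ le_rfl]
      rw [Finset.mem_range] at hj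
      convert zpow_zero _
      push_cast
      omega
  have hmu : ∏ i ∈ Finset.range (m + 1), ∏ j ∈ Finset.range (m + 1),
      mu ((i : ℤ) + j - m) ^ (H.1 i (j + 1) - K.1 i j) =
      ∏ i ∈ Finset.range m, ∏ j ∈ Finset.range m,
        mu ((i : ℤ) + 1 + j - m) ^ (H.1 (i + 1) (j + 1) - K.1 (i + 1) j) := by
    rw [Finset.prod_range_succ', Finset.prod_eq_one (s := Finset.range (m + 1)), mul_one]
    · refine Finset.prod_congr rfl fun i hi => ?_
      rw [Finset.prod_range_succ, H.2.right _ _ le_rfl, K.2.right _ _ le_rfl]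
      rw [Finset.mem_range] at hi
      push_cast
      convert mul_one _
      convert zpow_zero _
      omega
    · intro j hj
      rw [H.2.top, K.2.top, sub_zero, zpow_zero]
  rw [pairWeight, prod_zpow_mixedDiff_height H.2 H₀.2 X hX]
  simp only [Finset.prod_mul_distrib]
  rw [hlam, hmu]
  ring

/-! ### The local identity -/

theorem sum_Icc_self {R : Type*} [AddCommMonoid R] {a b : ℤ} (h : b = a) (f : ℤ → R) :
    ∑ k ∈ Finset.Icc a b, f k = f a := by
  subst h; simp

theorem sum_Icc_succ {R : Type*} [AddCommMonoid R] {a b : ℤ} (h : b = a + 1) (f : ℤ → R) :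
    ∑ k ∈ Finset.Icc a b, f k = f a + f (a + 1) := by
  subst h
  rw [show Finset.Icc a (a + 1) = {a, a + 1} by ext; simp; omega, Finset.sum_pair (by omega)]

/-- Here a, b, c, d are the values of the middle height function at the corners of a cell and d + a
- b - c is its entry. Entry 1: one term on the left, and the two on the right sum to x + y r. Entry
-1: two terms on the left, cancelled by the inverse. Entry 0: one equal term on each side. -/
theorem local_identity (x y r : F) (a b c d : ℤ) (hb : b = a ∨ b = a + 1) (hc : c = a ∨ c = a + 1)
    (hbd : d = b ∨ d = b + 1) (hcd : d = c ∨ d = c + 1) (hq : d + a - b - c = -1 → x + y * r ≠ 0) :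
    (x + y * r) ^ (d + a - b - c) *
      ∑ k ∈ Finset.Icc (max a (d - 1)) (min b c),
        x ^ (1 - d + k) * y ^ (c - k) * r ^ (min b c - k) =
    ∑ k ∈ Finset.Icc (max c b) (min (a + 1) d),
      x ^ (1 - k + a) * y ^ (k - b) * r ^ (k - max c b) := by
  obtain rfl | rfl := hb <;> obtain rfl | rfl := hc
  · obtain rfl | rfl := hbd
    · rw [sum_Icc_self (by omega), sum_Icc_self (by omega)]
      simp
    · rw [sum_Icc_self (by omega), sum_Icc_succ (by omega)]
      simp
  · obtain rfl : d = b + 1 := by omega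
    rw [sum_Icc_self (by omega), sum_Icc_self (by omega)]
    simp
  · obtain rfl : d = c + 1 := by omega
    rw [sum_Icc_self (by omega), sum_Icc_self (by omega)]
    simp
  · obtain rfl | rfl := hbd
    · rw [sum_Icc_succ (by omega), sum_Icc_self (by omega)]
      have h := hq (by ring)
      have e : a + 1 + a - (a + 1) - (a + 1) = -1 := by ring
      rw [e, zpow_neg_one]
      simp
      field_simp
      ring
    · rw [sum_Icc_self (by omega), sum_Icc_self (by omega)]
      simp [show a + 1 + 1 + a - (a + 1) - (a + 1) = 0 by ring]

end PairSum

/-! ### One step of the condensation -/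

section Step

variable {F : Type*} [Field F]

theorem IsHeight.mixedDiff_mem {n : ℕ} {H : ℕ → ℕ → ℤ} (hH : IsHeight n H) (i j : ℕ) :
    mixedDiff H i j = -1 ∨ mixedDiff H i j = 0 ∨ mixedDiff H i j = 1 := by
  have h1 := hH.le_down i j
  have h2 := hH.down_le i j
  have h3 := hH.le_down i (j + 1)
  have h4 := hH.down_le i (j + 1)
  simp only [mixedDiff]
  omega

/-- The first and last rows of an ASM have no negative entry. This confines the exponent -1 to the
interior, where nonvanishing is available. -/
theorem IsHeight.left_interior {n : ℕ} {H : ℕ → ℕ → ℤ} (hH : IsHeight n H) {i j : ℕ}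
    (h : mixedDiff H i j = -1) : 0 < i ∧ i + 1 < n := by
  constructor
  · by_contra hi
    obtain rfl : i = 0 := by omega
    have h1 := hH.le_across 1 j
    simp only [mixedDiff, hH.top, zero_add] at h
    omega
  · by_contra hi
    have h3 : i < n := by
      by_contra h4
      rw [hH.mixedDiff_eq_zero_of_le_left j (not_lt.1 h4)] at h
      omega
    have h5 : j < n := by
      by_contra h4
      rw [hH.mixedDiff_eq_zero_of_le_right i (not_lt.1 h4)] at h
      omega
    have h1 := hH.across_le i j
    simp only [mixedDiff, hH.bottom (i + 1) _ (by omega)] at h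
    push_cast at h
    omega

theorem mixedDiff_transpose (H : ℕ → ℕ → ℤ) (i j : ℕ) :
    mixedDiff (fun i j => H j i) j i = mixedDiff H i j := by
  simp only [mixedDiff]
  ring

theorem IsHeight.right_interior {n : ℕ} {H : ℕ → ℕ → ℤ} (hH : IsHeight n H) {i j : ℕ}
    (h : mixedDiff H i j = -1) : 0 < j ∧ j + 1 < n :=
  hH.transpose.left_interior (i := j) (j := i) (by rw [mixedDiff_transpose, h])

/-- The largest height function compatible with one of higher order. -/
theorem exists_lower_reference {l : ℕ} {K : ℕ → ℕ → ℤ} (hK : IsHeight (l + 1) K) :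
    ∃ K₀ : Height l, ∀ i < l + 1, ∀ j < l + 1, K₀.1 i j = min (K (i + 1) j) (K i (j + 1)) := by
  refine ⟨⟨lowerHeight l fun i j => min (K (i + 1) j) (K i (j + 1)),
    isHeight_lowerHeight hK fun i _ j _ => ?_⟩, fun i hi j hj => ?_⟩
  · have h1 := hK.le_down i j
    have h2 := hK.le_across i j
    have h3 := hK.across_le (i + 1) j
    have h4 := hK.down_le i (j + 1)
    simp only [lowerRange, Finset.mem_Icc]
    omega
  · simp only [lowerHeight]
    rw [min_eq_left (a := i) (by omega), min_eq_left (a := j) (by omega)]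

/-- The smallest height function compatible with one of lower order. -/
theorem exists_upper_reference {m : ℕ} {K : ℕ → ℕ → ℤ} (hK : IsHeight m K) :
    ∃ H₀ : Height (m + 1), ∀ i < m, ∀ j < m,
      H₀.1 (i + 1) (j + 1) = max (K i (j + 1)) (K (i + 1) j) := by
  refine ⟨⟨upperHeight m fun i j => max (K i (j + 1)) (K (i + 1) j),
    isHeight_upperHeight hK fun i _ j _ => ?_⟩, fun i hi j hj =>
      upperHeight_of_lt (fun i j => max (K i (j + 1)) (K (i + 1) j)) hi hj⟩
  have h1 := hK.down_le i j
  have h2 := hK.across_le i j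
  have h3 := hK.le_across (i + 1) j
  have h4 := hK.le_down i (j + 1)
  simp only [upperRange, Finset.mem_Icc]
  omega

/-- Taking mixed differences of `hrel` and shifting indices splits the exponents. This matches the
prefactors of the two inner sums and produces the antidiagonal products that factor out of the
recursion for T. -/
theorem prod_zpow_reference {l : ℕ} {H₀ K K₀ : ℕ → ℕ → ℤ} (hH₀ : IsHeight (l + 2) H₀)
    (hK : IsHeight (l + 1) K) (hK₀ : IsHeight l K₀)
    (hrel : ∀ i j, H₀ (i + 1) (j + 1) + K₀ i j = K (i + 1) j + K i (j + 1))
    (X : ℕ → ℕ → F) (hX : ∀ i < l + 2, ∀ j < l + 2, X i j ≠ 0) :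
    ∏ i ∈ Finset.range (l + 2), ∏ j ∈ Finset.range (l + 2), X i j ^ mixedDiff H₀ i j =
      (∏ i ∈ Finset.range (l + 1), ∏ j ∈ Finset.range (l + 1),
        (X (i + 1) j * X i (j + 1)) ^ mixedDiff K i j) *
      ∏ i ∈ Finset.range l, ∏ j ∈ Finset.range l, X (i + 1) (j + 1) ^ (-mixedDiff K₀ i j) := by
  have e00 : mixedDiff H₀ 0 0 = 0 := by
    have := hrel 0 0
    simp only [mixedDiff, hH₀.top, hH₀.left, hK.top, hK.left, hK₀.top] at *
    linarith
  have e0 : ∀ j, mixedDiff H₀ 0 (j + 1) = mixedDiff K 0 j := by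
    intro j
    have h1 := hrel 0 j
    have h2 := hrel 0 (j + 1)
    simp only [mixedDiff, hH₀.top, hK.top, hK₀.top] at *
    linarith
  have e1 : ∀ i, mixedDiff H₀ (i + 1) 0 = mixedDiff K i 0 := by
    intro i
    have h1 := hrel i 0
    have h2 := hrel (i + 1) 0
    simp only [mixedDiff, hH₀.left, hK.left, hK₀.left] at *
    linarith
  have e2 : ∀ i j, mixedDiff H₀ (i + 1) (j + 1) =
      mixedDiff K i (j + 1) + mixedDiff K (i + 1) j + -mixedDiff K₀ i j := by
    intro i j
    have h1 := hrel i j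
    have h2 := hrel (i + 1) j
    have h3 := hrel i (j + 1)
    have h4 := hrel (i + 1) (j + 1)
    simp only [mixedDiff] at *
    linarith
  have p1 : ∏ i ∈ Finset.range (l + 1), ∏ j ∈ Finset.range (l + 1), X (i + 1) j ^ mixedDiff K i j =
      (∏ i ∈ Finset.range (l + 1), ∏ j ∈ Finset.range (l + 1),
        X (i + 1) (j + 1) ^ mixedDiff K i (j + 1)) *
      ∏ i ∈ Finset.range (l + 1), X (i + 1) 0 ^ mixedDiff K i 0 := by
    rw [← Finset.prod_mul_distrib]
    refine Finset.prod_congr rfl fun i _ => ?_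
    rw [Finset.prod_range_succ', Finset.prod_range_succ (fun j => X (i + 1) (j + 1) ^ _),
      hK.mixedDiff_eq_zero_of_le_right i le_rfl, zpow_zero, mul_one]
  have p2 : ∏ i ∈ Finset.range (l + 1), ∏ j ∈ Finset.range (l + 1), X i (j + 1) ^ mixedDiff K i j =
      (∏ i ∈ Finset.range (l + 1), ∏ j ∈ Finset.range (l + 1),
        X (i + 1) (j + 1) ^ mixedDiff K (i + 1) j) *
      ∏ j ∈ Finset.range (l + 1), X 0 (j + 1) ^ mixedDiff K 0 j := by
    rw [Finset.prod_range_succ', Finset.prod_range_succ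
      (fun i => ∏ j ∈ Finset.range (l + 1), X (i + 1) (j + 1) ^ _)]
    simp only [hK.mixedDiff_eq_zero_of_le_left _ le_rfl, zpow_zero, Finset.prod_const_one, mul_one]
  have p3 : ∏ i ∈ Finset.range l, ∏ j ∈ Finset.range l, X (i + 1) (j + 1) ^ (-mixedDiff K₀ i j) =
      ∏ i ∈ Finset.range (l + 1), ∏ j ∈ Finset.range (l + 1),
        X (i + 1) (j + 1) ^ (-mixedDiff K₀ i j) := by
    simp only [Finset.prod_range_succ, hK₀.mixedDiff_eq_zero_of_le_left _ le_rfl,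
      hK₀.mixedDiff_eq_zero_of_le_right _ le_rfl, neg_zero, zpow_zero, Finset.prod_const_one,
      mul_one]
  have p4 : ∏ i ∈ Finset.range (l + 1), ∏ j ∈ Finset.range (l + 1),
        X (i + 1) (j + 1) ^ mixedDiff H₀ (i + 1) (j + 1) =
      ((∏ i ∈ Finset.range (l + 1), ∏ j ∈ Finset.range (l + 1),
        X (i + 1) (j + 1) ^ mixedDiff K i (j + 1)) *
      (∏ i ∈ Finset.range (l + 1), ∏ j ∈ Finset.range (l + 1),
        X (i + 1) (j + 1) ^ mixedDiff K (i + 1) j)) *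
      ∏ i ∈ Finset.range (l + 1), ∏ j ∈ Finset.range (l + 1),
        X (i + 1) (j + 1) ^ (-mixedDiff K₀ i j) := by
    simp only [← Finset.prod_mul_distrib]
    refine Finset.prod_congr rfl fun i hi => Finset.prod_congr rfl fun j hj => ?_
    rw [Finset.mem_range] at hi hj
    have := hX (i + 1) (by omega) (j + 1) (by omega)
    rw [e2, zpow_add₀ this, zpow_add₀ this]
  rw [p3]
  simp only [mul_zpow, Finset.prod_mul_distrib]
  rw [p1, p2, Finset.prod_range_succ', Finset.prod_range_succ' (fun j => X 0 j ^ _), e00, zpow_zero,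
    mul_one]
  simp only [e0]
  have p5 : ∀ i, ∏ j ∈ Finset.range (l + 2), X (i + 1) j ^ mixedDiff H₀ (i + 1) j =
      (∏ j ∈ Finset.range (l + 1), X (i + 1) (j + 1) ^ mixedDiff H₀ (i + 1) (j + 1)) *
        X (i + 1) 0 ^ mixedDiff K i 0 := by
    intro i
    rw [Finset.prod_range_succ', e1]
  simp only [p5, Finset.prod_mul_distrib]
  rw [p4]
  ring

/-- The identity holds for each middle height function `K` separately: the left inner sum runs over
height functions above `K`, the right one over those below. -/
theorem pairSum_step_of_ne_zero (l : ℕ) (X W T : ℕ → ℕ → F) (lam mu : ℤ → F)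
    (hX : ∀ i < l + 2, ∀ j < l + 2, X i j ≠ 0)
    (hT : ∀ i < l + 1, ∀ j < l + 1, T i j = (mu ((i : ℤ) + j - l) * X i j * X (i + 1) (j + 1) +
      lam ((j : ℤ) - i) * X (i + 1) j * X i (j + 1)) / W i j)
    (hT' : ∀ i < l, ∀ j < l, 0 < i → 0 < j → T i j ≠ 0) :
    pairSum (l + 1) X W lam mu = pairSum l T (fun i j => X (i + 1) (j + 1)) lam mu := by
  rw [pairSum, Finset.sum_comm, pairSum]
  refine Finset.sum_congr rfl fun K _ => ?_
  obtain ⟨K₀, hK₀⟩ := exists_lower_reference K.2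
  obtain ⟨H₀, hH₀⟩ := exists_upper_reference K.2
  -- The references are the maximum and the minimum of the same two values of `K`, hence have the
  -- same sum.
  have hrel : ∀ i j, H₀.1 (i + 1) (j + 1) + K₀.1 i j = K.1 (i + 1) j + K.1 i (j + 1) := by
    intro i j
    rcases lt_or_ge i (l + 1) with hi | hi
    · rcases lt_or_ge j (l + 1) with hj | hj
      · rw [hK₀ i hi j hj, hH₀ i hi j hj]
        omega
      · rw [H₀.2.right _ _ (by omega), K₀.2.right _ _ (by omega), K.2.right _ _ (by omega),
          K.2.right _ _ (by omega)]
        push_cast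
        omega
    · rw [H₀.2.bottom _ _ (by omega), K₀.2.bottom _ _ (by omega), K.2.bottom _ _ (by omega),
        K.2.bottom _ _ (by omega)]
      push_cast
      omega
  rw [sum_pairWeight_upper H₀ K X W lam mu hX, sum_pairWeight_lower K K₀ T X lam mu
    (fun i hi j hj => hX _ (by omega) _ (by omega)),
    prod_zpow_reference H₀.2 K.2 K₀.2 hrel X hX]
  have key : ∀ i ∈ Finset.range (l + 1), ∀ j ∈ Finset.range (l + 1),
      (X (i + 1) j * X i (j + 1)) ^ mixedDiff K.1 i j * W i j ^ (-mixedDiff K.1 i j) *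
      (∑ k ∈ upperRange K.1 i j, (lam ((j : ℤ) - i) ^ (1 - k + K.1 i j) *
        mu ((i : ℤ) + 1 + j - (l + 1 : ℕ)) ^ (k - K.1 (i + 1) j) *
          cross X i j ^ (k - H₀.1 (i + 1) (j + 1)))) =
      T i j ^ mixedDiff K.1 i j * ∑ k ∈ lowerRange K.1 i j,
        (lam ((j : ℤ) - i) ^ (1 - K.1 (i + 1) (j + 1) + k) *
          mu ((i : ℤ) + j - l) ^ (K.1 i (j + 1) - k) * cross X i j ^ (K₀.1 i j - k)) := by
    intro i hi j hj
    rw [Finset.mem_range] at hi hj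
    have hmu : (i : ℤ) + 1 + j - (l + 1 : ℕ) = i + j - l := by push_cast; ring
    have hb := hX (i + 1) (by omega) j (by omega)
    have hc := hX i (by omega) (j + 1) (by omega)
    have hTq : T i j = (X (i + 1) j * X i (j + 1)) / W i j *
        (lam ((j : ℤ) - i) + mu ((i : ℤ) + j - l) * cross X i j) := by
      rw [hT i hi j hj, cross]
      field_simp
      ring
    have h1 := K.2.le_down i j
    have h2 := K.2.down_le i j
    have h3 := K.2.le_across i j
    have h4 := K.2.across_le i j
    have h5 := K.2.le_across (i + 1) j
    have h6 := K.2.across_le (i + 1) j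
    have h7 := K.2.le_down i (j + 1)
    have h8 := K.2.down_le i (j + 1)
    have := local_identity (lam ((j : ℤ) - i)) (mu ((i : ℤ) + j - l)) (cross X i j) (K.1 i j)
      (K.1 (i + 1) j) (K.1 i (j + 1)) (K.1 (i + 1) (j + 1)) (by omega) (by omega) (by omega)
      -- The exponent -1 means an entry -1 of `K`, which lies in the interior, where `T` is nonzero.
      (by omega) (by
        intro hm hq
        have hm' : mixedDiff K.1 i j = -1 := by rw [mixedDiff]; omega
        have h9 := K.2.left_interior hm'
        have h10 := K.2.right_interior hm'
        refine hT' i (by omega) j (by omega) h9.1 h10.1 ?_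
        rw [hTq, hq, mul_zero])
    rw [hmu, hH₀ i hi j hj, hK₀ i hi j hj, upperRange, lowerRange, ← this, hTq,
      mul_zpow (_ / _), div_zpow, zpow_neg]
    have e : K.1 (i + 1) (j + 1) + K.1 i j - K.1 (i + 1) j - K.1 i (j + 1) =
        mixedDiff K.1 i j := rfl
    rw [e]
    ring
  have key' := Finset.prod_congr rfl fun i hi => Finset.prod_congr rfl (key i hi)
  simp only [Finset.prod_mul_distrib (s := Finset.range (l + 1))] at key' ⊢
  linear_combination (∏ i ∈ Finset.range l, ∏ j ∈ Finset.range l,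
    X (i + 1) (j + 1) ^ (-mixedDiff K₀.1 i j)) * key'

end Step

/-! ### Specialization of rational functions -/

section Specialization

variable {F : Type*} [Field F]

open Polynomial in
/-- The pairs `(f, f(0))`, where `f` is a rational function that is regular at `0`. -/
def specialization (F : Type*) [Field F] : Subring (RatFunc F × F) where
  carrier := {x | ∃ p q : F[X], q.eval 0 ≠ 0 ∧
    x.1 * algebraMap F[X] (RatFunc F) q = algebraMap F[X] (RatFunc F) p ∧
    x.2 * q.eval 0 = p.eval 0}
  mul_mem' := by
    rintro x y ⟨p, q, h1, h2, h3⟩ ⟨p', q', h1', h2', h3'⟩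
    refine ⟨p * p', q * q', by simp [h1, h1'], ?_, ?_⟩
    · rw [map_mul, map_mul, ← h2, ← h2', Prod.fst_mul]; ring
    · rw [eval_mul, eval_mul, ← h3, ← h3', Prod.snd_mul]; ring
  add_mem' := by
    rintro x y ⟨p, q, h1, h2, h3⟩ ⟨p', q', h1', h2', h3'⟩
    refine ⟨p * q' + p' * q, q * q', by simp [h1, h1'], ?_, ?_⟩
    · rw [map_mul, map_add, map_mul, map_mul, ← h2, ← h2', Prod.fst_add]; ring
    · rw [eval_mul, eval_add, eval_mul, eval_mul, ← h3, ← h3', Prod.snd_add]; ring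
  one_mem' := ⟨1, 1, by simp⟩
  zero_mem' := ⟨0, 1, by simp⟩
  neg_mem' := by
    rintro x ⟨p, q, h1, h2, h3⟩
    exact ⟨-p, q, h1, by rw [map_neg, ← h2, Prod.fst_neg, neg_mul],
      by rw [eval_neg, ← h3, Prod.snd_neg, neg_mul]⟩

open Polynomial in
theorem algebraMap_mem_specialization (p : F[X]) :
    (algebraMap F[X] (RatFunc F) p, p.eval 0) ∈ specialization F :=
  ⟨p, 1, by simp⟩

/-- This makes the value at 0 well defined: equal rational functions have equal values, and a
function with nonzero value is nonzero. -/
theorem eq_zero_of_mem_specialization {a : F} (h : ((0 : RatFunc F), a) ∈ specialization F) :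
    a = 0 := by
  obtain ⟨p, q, h1, h2, h3⟩ := h
  simp only [zero_mul] at h2 h3
  have hp : p = 0 := RatFunc.algebraMap_injective F (by rw [← h2, map_zero])
  rw [hp, Polynomial.eval_zero] at h3
  exact (mul_eq_zero.1 h3).resolve_right h1

theorem inv_mem_specialization {f : RatFunc F} {a : F} (h : (f, a) ∈ specialization F)
    (ha : a ≠ 0) : (f⁻¹, a⁻¹) ∈ specialization F := by
  have hf : f ≠ 0 := by
    rintro rfl
    exact ha (eq_zero_of_mem_specialization h)
  obtain ⟨p, q, h1, h2, h3⟩ := h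
  simp only at h2 h3
  refine ⟨q, p, ?_, ?_, ?_⟩
  · rw [← h3]
    exact mul_ne_zero ha h1
  · simp only [← h2, inv_mul_cancel_left₀ hf]
  · simp only [← h3, inv_mul_cancel_left₀ ha]

theorem zpow_mem_specialization {f : RatFunc F} {a : F} (h : (f, a) ∈ specialization F) {e : ℤ}
    (he : e = -1 ∨ e = 0 ∨ e = 1) (ha : e = -1 → a ≠ 0) :
    (f ^ e, a ^ e) ∈ specialization F := by
  obtain rfl | rfl | rfl := he
  · simpa using inv_mem_specialization h (ha rfl)
  · rw [zpow_zero, zpow_zero]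
    exact (specialization F).one_mem
  · simpa using h

theorem prod_mem_specialization {ι : Type*} (s : Finset ι) (f : ι → RatFunc F) (a : ι → F)
    (h : ∀ i ∈ s, (f i, a i) ∈ specialization F) :
    (∏ i ∈ s, f i, ∏ i ∈ s, a i) ∈ specialization F := by
  have h' := Subring.prod_mem _ h
  rwa [← Prod.mk.eta (p := Finset.prod s _), Prod.fst_prod, Prod.snd_prod] at h'

theorem sum_mem_specialization {ι : Type*} (s : Finset ι) (f : ι → RatFunc F) (a : ι → F)
    (h : ∀ i ∈ s, (f i, a i) ∈ specialization F) :
    (∑ i ∈ s, f i, ∑ i ∈ s, a i) ∈ specialization F := by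
  have h' := Subring.sum_mem _ h
  rwa [← Prod.mk.eta (p := Finset.sum s _), Prod.fst_sum, Prod.snd_sum] at h'

theorem mul_mem_specialization {f g : RatFunc F} {a b : F} (h : (f, a) ∈ specialization F)
    (h' : (g, b) ∈ specialization F) : (f * g, a * b) ∈ specialization F :=
  (specialization F).mul_mem h h'

theorem add_mem_specialization {f g : RatFunc F} {a b : F} (h : (f, a) ∈ specialization F)
    (h' : (g, b) ∈ specialization F) : (f + g, a + b) ∈ specialization F :=
  (specialization F).add_mem h h'

/-- Every exponent is -1, 0 or 1. Those of λ and μ are never negative, and an entry of `X` is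
inverted only in the interior, so only nonzero values are ever inverted. -/
theorem pairSum_mem_specialization {m : ℕ} {X' W' : ℕ → ℕ → RatFunc F} {X W : ℕ → ℕ → F}
    {lam' mu' : ℤ → RatFunc F} {lam mu : ℤ → F}
    (hX : ∀ i < m + 1, ∀ j < m + 1, (X' i j, X i j) ∈ specialization F)
    (hX0 : ∀ i < m, ∀ j < m, 0 < i → 0 < j → X i j ≠ 0)
    (hW : ∀ i < m, ∀ j < m, (W' i j, W i j) ∈ specialization F)
    (hW0 : ∀ i < m, ∀ j < m, W i j ≠ 0)
    (hlam : ∀ a, (lam' a, lam a) ∈ specialization F)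
    (hmu : ∀ a, (mu' a, mu a) ∈ specialization F) :
    (pairSum m X' W' lam' mu', pairSum m X W lam mu) ∈ specialization F := by
  refine sum_mem_specialization _ _ _ fun H _ => sum_mem_specialization _ _ _ fun K _ => ?_
  split_ifs with hHK
  · refine mul_mem_specialization (mul_mem_specialization ?_ ?_) ?_ <;>
      refine prod_mem_specialization _ _ _ fun i hi =>
        prod_mem_specialization _ _ _ fun j hj => ?_ <;> rw [Finset.mem_range] at hi hj
    · refine zpow_mem_specialization (hX i hi j hj) (H.2.mixedDiff_mem i j) fun h => ?_
      have h1 := H.2.left_interior h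
      have h2 := H.2.right_interior h
      exact hX0 i (by omega) j (by omega) h1.1 h2.1
    · have h := hHK i hi j hj
      have h1 := H.2.across_le i j
      have h2 := H.2.le_down i (j + 1)
      refine mul_mem_specialization (zpow_mem_specialization (hlam _) ?_ ?_)
        (zpow_mem_specialization (hmu _) ?_ ?_) <;> omega
    · refine zpow_mem_specialization (hW i hi j hj) ?_ fun _ => hW0 i hi j hj
      have := K.2.mixedDiff_mem i j
      omega
  · exact (specialization F).zero_mem

open Polynomial in
/-- One step of the condensation preserves the generating function of compatible pairs. -/
theorem pairSum_step (l : ℕ) (X W T : ℕ → ℕ → F) (lam mu : ℤ → F)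
    (hX : ∀ i < l + 1, ∀ j < l + 1, 0 < i → 0 < j → X i j ≠ 0)
    (hW : ∀ i < l + 1, ∀ j < l + 1, W i j ≠ 0)
    (hT : ∀ i < l + 1, ∀ j < l + 1, T i j = (mu ((i : ℤ) + j - l) * X i j * X (i + 1) (j + 1) +
      lam ((j : ℤ) - i) * X (i + 1) j * X i (j + 1)) / W i j)
    (hT' : ∀ i < l, ∀ j < l, 0 < i → 0 < j → T i j ≠ 0) :
    pairSum (l + 1) X W lam mu = pairSum l T (fun i j => X (i + 1) (j + 1)) lam mu := by
  have hC : ∀ a : F, (algebraMap F[X] (RatFunc F) (C a), a) ∈ specialization F := fun a => by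
    simpa using algebraMap_mem_specialization (C a)
  classical
  -- Vanishing entries are perturbed to the indeterminate, so that all entries become nonzero and
  -- evaluation at 0 recovers `X`.
  let P : ℕ → ℕ → F[X] := fun i j => if X i j = 0 then Polynomial.X else C (X i j)
  let X' : ℕ → ℕ → RatFunc F := fun i j => algebraMap F[X] (RatFunc F) (P i j)
  let W' : ℕ → ℕ → RatFunc F := fun i j => algebraMap F[X] (RatFunc F) (C (W i j))
  let lam' : ℤ → RatFunc F := fun a => algebraMap F[X] (RatFunc F) (C (lam a))
  let mu' : ℤ → RatFunc F := fun a => algebraMap F[X] (RatFunc F) (C (mu a))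
  let T' : ℕ → ℕ → RatFunc F := fun i j =>
    (mu' ((i : ℤ) + j - l) * X' i j * X' (i + 1) (j + 1) +
      lam' ((j : ℤ) - i) * X' (i + 1) j * X' i (j + 1)) / W' i j
  have hXS : ∀ i j, (X' i j, X i j) ∈ specialization F := by
    intro i j
    have h : (P i j).eval 0 = X i j := by
      simp only [P]
      split_ifs with h <;> simp [h]
    rw [← h]
    exact algebraMap_mem_specialization _
  have hTS : ∀ i < l + 1, ∀ j < l + 1, (T' i j, T i j) ∈ specialization F := by
    intro i hi j hj
    rw [hT i hi j hj, div_eq_mul_inv]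
    simp only [T', div_eq_mul_inv]
    exact mul_mem_specialization (add_mem_specialization
      (mul_mem_specialization (mul_mem_specialization (hC _) (hXS _ _)) (hXS _ _))
      (mul_mem_specialization (mul_mem_specialization (hC _) (hXS _ _)) (hXS _ _)))
      (inv_mem_specialization (hC _) (hW i hi j hj))
  have hstep : pairSum (l + 1) X' W' lam' mu' =
      pairSum l T' (fun i j => X' (i + 1) (j + 1)) lam' mu' := by
    refine pairSum_step_of_ne_zero l X' W' T' lam' mu' (fun i _ j _ => ?_) (fun i _ j _ => rfl)
      fun i hi j hj hi' hj' h => ?_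
    · refine RatFunc.algebraMap_ne_zero ?_
      simp only [P]
      split_ifs with h
      · exact Polynomial.X_ne_zero
      · simpa using h
    · have := hTS i (by omega) j (by omega)
      rw [h] at this
      exact hT' i hi j hj hi' hj' (eq_zero_of_mem_specialization this)
  have h1 : (pairSum (l + 1) X' W' lam' mu', pairSum (l + 1) X W lam mu) ∈ specialization F :=
    pairSum_mem_specialization (fun i _ j _ => hXS i j) hX (fun i _ j _ => hC _) hW
      (fun _ => hC _) (fun _ => hC _)
  have h2 : (pairSum l T' (fun i j => X' (i + 1) (j + 1)) lam' mu',
      pairSum l T (fun i j => X (i + 1) (j + 1)) lam mu) ∈ specialization F :=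
    pairSum_mem_specialization hTS hT' (fun i _ j _ => hXS _ _)
      (fun i hi j hj => hX _ (by omega) _ (by omega) (by omega) (by omega))
      (fun _ => hC _) (fun _ => hC _)
  -- The two rational functions coincide, so the difference of the pairs has first component 0 and
  -- hence second component 0.
  have h3 := (specialization F).sub_mem h1 h2
  rw [hstep, Prod.mk_sub_mk, sub_self] at h3
  exact sub_eq_zero.1 (eq_zero_of_mem_specialization h3)

end Specialization

/-! ### Contiguous minors -/

section Blocks

variable {F : Type*}

/-- The contiguous `k × k` submatrix of an infinite matrix with upper left corner `(i, j)`. -/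
def block (a : ℕ → ℕ → F) (k i j : ℕ) : Matrix (Fin k) (Fin k) F :=
  fun p q => a (i + p) (j + q)

theorem minorFF_block (a : ℕ → ℕ → F) (k i j : ℕ) :
    minorFF (block a (k + 1) i j) = block a k (i + 1) (j + 1) := by
  ext p q
  simp [minorFF, block, add_assoc, add_comm 1]

theorem minorLL_block (a : ℕ → ℕ → F) (k i j : ℕ) :
    minorLL (block a (k + 1) i j) = block a k i j := by
  ext p q
  simp [minorLL, block]

theorem minorFL_block (a : ℕ → ℕ → F) (k i j : ℕ) :
    minorFL (block a (k + 1) i j) = block a k (i + 1) j := by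
  ext p q
  simp [minorFL, block, add_assoc, add_comm 1]

theorem minorLF_block (a : ℕ → ℕ → F) (k i j : ℕ) :
    minorLF (block a (k + 1) i j) = block a k i (j + 1) := by
  ext p q
  simp [minorLF, block, add_assoc, add_comm 1]

theorem interior_block (a : ℕ → ℕ → F) (k i j : ℕ) :
    interior (block a (k + 2) i j) = block a k (i + 1) (j + 1) := by
  ext p q
  simp [interior, block, add_assoc, add_comm 1]

theorem shift_shift (f : ℤ → F) {k l m : ℤ} (h : k + l = m) : shift k (shift l f) = shift m f := by
  ext a
  simp only [shift, ← h, add_assoc]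

variable [Field F]

/-- The Lambda-determinants of the contiguous minors, with shifted parameters. -/
def blockDet (n : ℕ) (a : ℕ → ℕ → F) (lam mu : ℤ → F) (k i j : ℕ) : F :=
  lambdaDet k (block a k i j) (shift ((j : ℤ) - i) lam) (shift ((i : ℤ) + j + k - n) mu)

/-- The recursion of the contiguous minors makes sense. -/
def BlockCondensable (n : ℕ) (a : ℕ → ℕ → F) (lam mu : ℤ → F) (k i j : ℕ) : Prop :=
  Condensable k (block a k i j) (shift ((j : ℤ) - i) lam) (shift ((i : ℤ) + j + k - n) mu)

theorem blockDet_succ_succ (n : ℕ) (a : ℕ → ℕ → F) (lam mu : ℤ → F) (k i j : ℕ) :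
    blockDet n a lam mu (k + 2) i j =
      (mu ((i : ℤ) + j + k + 2 - n) * blockDet n a lam mu (k + 1) i j *
          blockDet n a lam mu (k + 1) (i + 1) (j + 1) +
        lam ((j : ℤ) - i) * blockDet n a lam mu (k + 1) (i + 1) j *
          blockDet n a lam mu (k + 1) i (j + 1)) / blockDet n a lam mu k (i + 1) (j + 1) := by
  simp only [blockDet]
  rw [lambdaDet, minorFF_block, minorLL_block, minorFL_block, minorLF_block, interior_block]
  rw [shift_shift mu (m := ((i + 1 : ℕ) : ℤ) + (j + 1 : ℕ) + (k + 1 : ℕ) - n) (by push_cast; ring),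
    shift_shift mu (m := (i : ℤ) + j + (k + 1 : ℕ) - n) (by push_cast; ring),
    shift_shift lam (m := (j : ℤ) - (i + 1 : ℕ)) (by push_cast; ring),
    shift_shift lam (m := ((j + 1 : ℕ) : ℤ) - i) (by push_cast; ring)]
  have e1 : ((j + 1 : ℕ) : ℤ) - (i + 1 : ℕ) = j - i := by push_cast; ring
  have e2 : ((i + 1 : ℕ) : ℤ) + (j + 1 : ℕ) + k - n = i + j + (k + 2 : ℕ) - n := by push_cast; ring
  have e3 : ((i + 1 : ℕ) : ℤ) + j + (k + 1 : ℕ) - n = i + j + (k + 2 : ℕ) - n := by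
    push_cast; ring
  have e4 : (i : ℤ) + (j + 1 : ℕ) + (k + 1 : ℕ) - n = i + j + (k + 2 : ℕ) - n := by
    push_cast; ring
  have e5 : shift ((i : ℤ) + j + (k + 2 : ℕ) - n) mu 0 = mu ((i : ℤ) + j + k + 2 - n) := by
    simp only [shift]
    congr 1
    push_cast
    ring
  have e6 : shift ((j : ℤ) - i) lam 0 = lam ((j : ℤ) - i) := by simp [shift]
  rw [e1, e2, e3, e4, e5, e6]
  ring

theorem blockCondensable_succ_succ (n : ℕ) (a : ℕ → ℕ → F) (lam mu : ℤ → F) (k i j : ℕ)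
    (h : BlockCondensable n a lam mu (k + 2) i j) :
    BlockCondensable n a lam mu (k + 1) (i + 1) (j + 1) ∧
    BlockCondensable n a lam mu (k + 1) i j ∧
    BlockCondensable n a lam mu (k + 1) (i + 1) j ∧
    BlockCondensable n a lam mu (k + 1) i (j + 1) ∧
    blockDet n a lam mu k (i + 1) (j + 1) ≠ 0 := by
  simp only [BlockCondensable, blockDet] at *
  rw [Condensable, minorFF_block, minorLL_block, minorFL_block, minorLF_block, interior_block] at h
  rw [shift_shift mu (m := ((i + 1 : ℕ) : ℤ) + (j + 1 : ℕ) + (k + 1 : ℕ) - n) (by push_cast; ring),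
    shift_shift mu (m := (i : ℤ) + j + (k + 1 : ℕ) - n) (by push_cast; ring),
    shift_shift lam (m := (j : ℤ) - (i + 1 : ℕ)) (by push_cast; ring),
    shift_shift lam (m := ((j + 1 : ℕ) : ℤ) - i) (by push_cast; ring)] at h
  have e1 : ((j + 1 : ℕ) : ℤ) - (i + 1 : ℕ) = j - i := by push_cast; ring
  have e2 : ((i + 1 : ℕ) : ℤ) + (j + 1 : ℕ) + k - n = i + j + (k + 2 : ℕ) - n := by push_cast; ring
  have e3 : ((i + 1 : ℕ) : ℤ) + j + (k + 1 : ℕ) - n = i + j + (k + 2 : ℕ) - n := by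
    push_cast; ring
  have e4 : (i : ℤ) + (j + 1 : ℕ) + (k + 1 : ℕ) - n = i + j + (k + 2 : ℕ) - n := by
    push_cast; ring
  rw [e1, e2, e3, e4]
  exact ⟨h.1, h.2.1, h.2.2.1, h.2.2.2.1, h.2.2.2.2.2⟩

/-- Descending induction on the size: every smaller nonempty block is a corner minor of a block one
size larger. Which corner depends on whether it touches the last row or the last column. -/
theorem BlockCondensable.of_top {n : ℕ} {a : ℕ → ℕ → F} {lam mu : ℤ → F}
    (h : BlockCondensable n a lam mu n 0 0) (d k i j : ℕ) (hk : k + d = n) (hi : i + k ≤ n)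
    (hj : j + k ≤ n) : BlockCondensable n a lam mu k i j := by
  induction d generalizing k i j with
  | zero =>
    obtain rfl : k = n := by omega
    obtain rfl : i = 0 := by omega
    obtain rfl : j = 0 := by omega
    exact h
  | succ d ih =>
    rcases k with _ | k
    · simp [BlockCondensable, Condensable]
    have ih' := fun i j hi hj =>
      blockCondensable_succ_succ n a lam mu k i j (ih (k + 2) i j (by omega) hi hj)
    rcases Nat.lt_or_ge (i + (k + 1)) n with hi' | hi'
    · rcases Nat.lt_or_ge (j + (k + 1)) n with hj' | hj'
      · exact (ih' i j (by omega) (by omega)).2.1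
      · obtain ⟨j, rfl⟩ : ∃ j', j = j' + 1 := ⟨j - 1, by omega⟩
        exact (ih' i j (by omega) (by omega)).2.2.2.1
    · obtain ⟨i, rfl⟩ : ∃ i', i = i' + 1 := ⟨i - 1, by omega⟩
      rcases Nat.lt_or_ge (j + (k + 1)) n with hj' | hj'
      · exact (ih' i j (by omega) (by omega)).2.2.1
      · obtain ⟨j, rfl⟩ : ∃ j', j = j' + 1 := ⟨j - 1, by omega⟩
        exact (ih' i j (by omega) (by omega)).1

/-- A block avoiding the border is the interior of a block two sizes larger, so its determinant is
one of the denominators. -/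
theorem BlockCondensable.blockDet_ne_zero {n : ℕ} {a : ℕ → ℕ → F} {lam mu : ℤ → F}
    (h : BlockCondensable n a lam mu n 0 0) {k i j : ℕ} (hi : 0 < i) (hj : 0 < j)
    (hi' : i + k < n) (hj' : j + k < n) : blockDet n a lam mu k i j ≠ 0 := by
  obtain ⟨i, rfl⟩ : ∃ i', i = i' + 1 := ⟨i - 1, by omega⟩
  obtain ⟨j, rfl⟩ : ∃ j', j = j' + 1 := ⟨j - 1, by omega⟩
  exact (blockCondensable_succ_succ n a lam mu k i j
    (h.of_top (n - (k + 2)) (k + 2) i j (by omega) (by omega) (by omega))).2.2.2.2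

theorem pairSum_blockDet {N : ℕ} {a : ℕ → ℕ → F} {lam mu : ℤ → F}
    (h : BlockCondensable (N + 1) a lam mu (N + 1) 0 0) (k l : ℕ) (hkl : l + k = N) :
    pairSum N (blockDet (N + 1) a lam mu 1)
        (fun i j => blockDet (N + 1) a lam mu 0 (i + 1) (j + 1)) lam mu =
      pairSum l (blockDet (N + 1) a lam mu (k + 1))
        (fun i j => blockDet (N + 1) a lam mu k (i + 1) (j + 1)) lam mu := by
  induction k generalizing l with
  | zero =>
    obtain rfl : l = N := by omega
    rfl
  | succ k ih =>
    rw [ih (l + 1) (by omega)]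
    refine pairSum_step l _ _ _ lam mu ?_ ?_ ?_ ?_
    · intro i hi j hj hi' hj'
      exact h.blockDet_ne_zero hi' hj' (by omega) (by omega)
    · intro i hi j hj
      exact h.blockDet_ne_zero (by omega) (by omega) (by omega) (by omega)
    · intro i hi j hj
      rw [blockDet_succ_succ]
      have : (i : ℤ) + j + k + 2 - (N + 1 : ℕ) = i + j - l := by
        push_cast [← hkl]
        ring
      rw [this]
    · intro i hi j hj hi' hj'
      exact h.blockDet_ne_zero hi' hj' (by omega) (by omega)

end Blocks

/-! ### The smallest orders -/

section Base

variable {F : Type*} [Field F]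

theorem isHeight_zero : IsHeight 0 (fun _ _ => 0) := by
  constructor <;> intros <;> simp

theorem isHeight_one : IsHeight 1 (fun i j : ℕ => min (min (i : ℤ) j) 1) := by
  constructor <;> intros <;> push_cast <;> omega

theorem IsHeight.eq_zero {H : ℕ → ℕ → ℤ} (hH : IsHeight 0 H) : H = fun _ _ => 0 := by
  ext i j
  rw [hH.bottom i j (Nat.zero_le i)]
  simp

theorem IsHeight.eq_one {H : ℕ → ℕ → ℤ} (hH : IsHeight 1 H) :
    H = fun i j : ℕ => min (min (i : ℤ) j) 1 := by
  ext i j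
  rcases Nat.eq_zero_or_pos i with rfl | hi
  · rw [hH.top]; omega
  · rw [hH.bottom i j hi]; omega

theorem pairSum_zero (X W : ℕ → ℕ → F) (lam mu : ℤ → F) : pairSum 0 X W lam mu = X 0 0 := by
  let u0 : Unique (Height 0) := ⟨⟨⟨_, isHeight_zero⟩⟩, fun H => Subtype.ext H.2.eq_zero⟩
  let u1 : Unique (Height (0 + 1)) := ⟨⟨⟨_, isHeight_one⟩⟩, fun H => Subtype.ext H.2.eq_one⟩
  rw [pairSum, Fintype.sum_unique, Fintype.sum_unique]
  have e1 : (default : Height (0 + 1)).1 = fun i j : ℕ => min (min (i : ℤ) j) 1 := rfl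
  have e0 : (default : Height 0).1 = fun _ _ => 0 := rfl
  rw [e0, e1, if_pos]
  · simp [pairWeight, mixedDiff]
  · intro i hi j hj
    obtain rfl : i = 0 := by omega
    obtain rfl : j = 0 := by omega
    simp

end Base

/-! ### The expansion over alternating sign matrices -/

section Expansion

variable {F : Type*} [Field F]

/-- The range is a single point except at a `c₂` vertex, where its two points give μ and λ. At the
other vertices the one term is λ for `a₁`, μ for `b₁` and 1 otherwise. -/
theorem weight_heightEquiv {n : ℕ} (A : Matrix (Fin n) (Fin n) F) (H : Height n) (lam mu : ℤ → F)
    (i j : Fin n) :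
    weight A (heightEquiv n H) lam mu i j = A i j ^ mixedDiff H.1 i j *
      ∑ k ∈ lowerRange H.1 i j, (lam ((j : ℤ) - i) ^ (1 - H.1 (i + 1) (j + 1) + k) *
          mu ((i : ℤ) + j + 1 - n) ^ (H.1 i (j + 1) - k)) := by
  rw [weight]
  congr 1
  have h1 : (heightEquiv n H).config.right i j.castSucc = decide (H.1 (i + 1) j - H.1 i j = 0) := by
    rw [← H.2.rowSum_diffMatrix i j.2.le]; rfl
  have h2 : (heightEquiv n H).config.right i j.succ =
      decide (H.1 (i + 1) (j + 1) - H.1 i (j + 1) = 0) := by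
    rw [← H.2.rowSum_diffMatrix i (Nat.succ_le_of_lt j.2)]; rfl
  have h3 : (heightEquiv n H).config.up i.castSucc j = decide (H.1 i (j + 1) - H.1 i j = 0) := by
    rw [← H.2.colSum_diffMatrix j i.2.le]; rfl
  rw [SixVertexDWBC.vertex, h1, h2, h3, lowerRange]
  have g1 := H.2.le_down i j
  have g2 := H.2.down_le i j
  have g3 := H.2.le_across i j
  have g4 := H.2.across_le i j
  have g5 := H.2.le_across (i + 1) j
  have g6 := H.2.across_le (i + 1) j
  have g7 := H.2.le_down i (j + 1)
  have g8 := H.2.down_le i (j + 1)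
  generalize lam ((j : ℤ) - i) = x
  generalize mu ((i : ℤ) + j + 1 - n) = y
  generalize H.1 i j = a at *
  generalize H.1 (i + 1) j = b at *
  generalize H.1 i (j + 1) = c at *
  generalize H.1 (i + 1) (j + 1) = d at *
  clear h1 h2 h3
  obtain rfl | rfl : b = a ∨ b = a + 1 := by omega
  · obtain rfl | rfl : c = b ∨ c = b + 1 := by omega
    · obtain rfl | rfl : d = c ∨ d = c + 1 := by omega
      · rw [sum_Icc_self (by omega)]; simp
      · rw [sum_Icc_self (by omega)]; simp
    · obtain rfl : d = b + 1 := by omega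
      rw [sum_Icc_self (by omega)]; simp
  · obtain rfl | rfl : c = a ∨ c = a + 1 := by omega
    · obtain rfl : d = c + 1 := by omega
      rw [sum_Icc_self (by omega)]; simp
    · obtain rfl | rfl : d = a + 1 ∨ d = a + 1 + 1 := by omega
      · rw [sum_Icc_succ (by omega)]; simp [add_comm]
      · rw [sum_Icc_self (by omega)]; simp

theorem sum_weight_eq_pairSum {N : ℕ} (A : Matrix (Fin (N + 1)) (Fin (N + 1)) F) (lam mu : ℤ → F) :
    ∑ B : ASM (N + 1), ∏ i, ∏ j, weight A B lam mu i j =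
      pairSum N (extend 0 A) (fun _ _ => 1) lam mu := by
  rw [pairSum, ← (heightEquiv (N + 1)).sum_comp]
  refine Finset.sum_congr rfl fun H _ => ?_
  have h : ∀ K : ℕ → ℕ → ℤ, pairWeight N (extend 0 A) (fun _ _ => 1) lam mu H.1 K =
      ∏ i ∈ Finset.range (N + 1), ∏ j ∈ Finset.range (N + 1),
        (extend 0 A i j ^ mixedDiff H.1 i j *
          (lam ((j : ℤ) - i) ^ (1 - H.1 (i + 1) (j + 1) + K i j) *
            mu ((i : ℤ) + j - N) ^ (H.1 i (j + 1) - K i j))) := by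
    intro K
    simp [pairWeight, Finset.prod_mul_distrib]
  simp only [h]
  rw [sum_compatible_lower H (fun i j k => extend 0 A i j ^ mixedDiff H.1 i j *
    (lam ((j : ℤ) - i) ^ (1 - H.1 (i + 1) (j + 1) + k) *
      mu ((i : ℤ) + j - N) ^ (H.1 i (j + 1) - k))), ← Fin.prod_univ_eq_prod_range]
  refine Finset.prod_congr rfl fun i _ => ?_
  rw [← Fin.prod_univ_eq_prod_range]
  refine Finset.prod_congr rfl fun j _ => ?_
  rw [weight_heightEquiv, Finset.mul_sum]
  refine Finset.sum_congr rfl fun k _ => ?_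
  rw [extend_val, show (i : ℤ) + j + 1 - (N + 1 : ℕ) = i + j - N by push_cast; ring]

theorem block_extend {n : ℕ} (A : Matrix (Fin n) (Fin n) F) : block (extend 0 A) n 0 0 = A := by
  ext i j
  simp [block]

theorem blockDet_top {n : ℕ} (A : Matrix (Fin n) (Fin n) F) (lam mu : ℤ → F) :
    blockDet n (extend 0 A) lam mu n 0 0 = lambdaDet n A lam mu := by
  have h : ∀ f : ℤ → F, shift 0 f = f := fun f => by ext; simp [shift]
  simp [blockDet, block_extend, h]

theorem blockCondensable_top {n : ℕ} (A : Matrix (Fin n) (Fin n) F) (lam mu : ℤ → F) :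
    BlockCondensable n (extend 0 A) lam mu n 0 0 ↔ Condensable n A lam mu := by
  have h : ∀ f : ℤ → F, shift 0 f = f := fun f => by ext; simp [shift]
  simp [BlockCondensable, block_extend, h]

/-- The expansion of the generalized Lambda-determinant over alternating sign matrices. -/
theorem lambdaDet_eq_sum (n : ℕ) (A : Matrix (Fin n) (Fin n) F) (lam mu : ℤ → F)
    (hA : Condensable n A lam mu) :
    lambdaDet n A lam mu = ∑ B : ASM n, ∏ i, ∏ j, weight A B lam mu i j := by
  rcases n with _ | N
  · let u : Unique (ASM 0) :=
      { default := heightEquiv 0 ⟨_, isHeight_zero⟩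
        uniq := fun B => Subtype.ext (Subsingleton.elim _ _) }
    rw [Fintype.sum_unique]
    simp [lambdaDet]
  · rw [sum_weight_eq_pairSum]
    have h := pairSum_blockDet ((blockCondensable_top A lam mu).2 hA) N 0 (zero_add N)
    rw [pairSum_zero, blockDet_top] at h
    rw [← h]
    congr 1

end Expansion

/-! ### The generic matrix -/

section Generic

variable {F : Type*} [Field F]

theorem rowSum_one {n : ℕ} (i : Fin n) (k : ℕ) :
    rowSum (1 : Matrix (Fin n) (Fin n) ℤ) i k = if (i : ℕ) < k then 1 else 0 := by
  simp only [rowSum, Matrix.one_apply, ← ite_and]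
  rw [Finset.sum_eq_single i]
  · simp
  · intro j _ hj
    simp [hj.symm]
  · simp

theorem colSum_one {n : ℕ} (k : ℕ) (j : Fin n) :
    colSum (1 : Matrix (Fin n) (Fin n) ℤ) k j = if (j : ℕ) < k then 1 else 0 := by
  rw [← rowSum_one]
  simp only [colSum, rowSum, Matrix.one_apply, eq_comm]

theorem isASM_one (n : ℕ) : IsASM (1 : Matrix (Fin n) (Fin n) ℤ) where
  entry i j := by
    rw [Matrix.one_apply]
    split_ifs <;> simp
  row_partial i k _ := by
    rw [rowSum_one]
    split_ifs <;> simp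
  col_partial j k _ := by
    rw [colSum_one]
    split_ifs <;> simp
  row_total i := by simp [Matrix.one_apply]
  col_total j := by simp [Matrix.one_apply]

/-- The identity matrix as an alternating sign matrix. -/
def oneASM (n : ℕ) : ASM n := ⟨1, isASM_one n⟩

theorem oneASM_val (n : ℕ) : (oneASM n).1 = 1 := rfl

/-- The factor of the local weight that depends on the parameters only. -/
def paramWeight {n : ℕ} (B : ASM n) (lam mu : ℤ → F) (i j : Fin n) : F :=
  match B.config.vertex i j with
  | .a₁ => lam ((j : ℤ) - i)
  | .b₁ => mu ((i : ℤ) + j + 1 - n)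
  | .c₂ => lam ((j : ℤ) - i) + mu ((i : ℤ) + j + 1 - n)
  | _ => 1

/-- For the identity matrix the vertices are `c₁` on the diagonal, `b₂` above it and `b₁` below it.
Below the diagonal the two corners with i + j = 0 and i + j = 2n - 2 are excluded, which keeps the
index of μ within n - 2 in absolute value. -/
theorem paramWeight_one_ne_zero {n : ℕ} (lam mu : ℤ → F)
    (hmu : ∀ a : ℤ, |a| ≤ (n : ℤ) - 2 → mu a ≠ 0) (i j : Fin n) :
    paramWeight (oneASM n) lam mu i j ≠ 0 := by
  simp only [paramWeight, SixVertexDWBC.vertex, ASM.config, Fin.val_castSucc, Fin.val_succ,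
    oneASM_val, rowSum_one, colSum_one]
  rcases lt_trichotomy i j with h | h | h
  · have h' := Fin.lt_def.1 h
    simp [h', h'.not_gt, show (i : ℕ) < j + 1 by omega]
  · simp [h]
  · have h' := Fin.lt_def.1 h
    have := i.2
    simp only [h'.not_gt, show ¬ (i : ℕ) < j + 1 by omega, h', if_true, if_false]
    refine hmu _ ?_
    rw [abs_le]
    constructor <;> omega

variable {K : Type*} [Field K] [Algebra F K]

theorem paramWeight_algebraMap {n : ℕ} (B : ASM n) (lam mu : ℤ → F) (i j : Fin n) :
    paramWeight B (fun a => algebraMap F K (lam a)) (fun a => algebraMap F K (mu a)) i j =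
      algebraMap F K (paramWeight B lam mu i j) := by
  simp only [paramWeight]
  cases B.config.vertex i j <;> simp

/-- The exponents of the monomial of an alternating sign matrix, multiplied by all the
indeterminates. -/
noncomputable def asmExponent {n : ℕ} (B : ASM n) : (Fin n × Fin n) →₀ ℕ :=
  Finsupp.equivFunOnFinite.symm fun x => (1 + B.1 x.1 x.2).toNat

theorem asmExponent_injective (n : ℕ) : Function.Injective (asmExponent (n := n)) := by
  intro B B' h
  refine Subtype.ext ?_
  ext i j
  have h1 := DFunLike.congr_fun h (i, j)
  simp only [asmExponent, Finsupp.equivFunOnFinite_symm_apply_apply] at h1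
  have h2 := B.2.entry i j
  have h3 := B'.2.entry i j
  omega

/-- The numerator of the expansion, as a polynomial in the entries of the matrix. -/
noncomputable def numerator (n : ℕ) (lam mu : ℤ → F) : MvPolynomial (Fin n × Fin n) F :=
  ∑ B : ASM n, MvPolynomial.monomial (asmExponent B) (∏ i, ∏ j, paramWeight B lam mu i j)

theorem numerator_ne_zero {n : ℕ} (lam mu : ℤ → F)
    (hmu : ∀ a : ℤ, |a| ≤ (n : ℤ) - 2 → mu a ≠ 0) : numerator n lam mu ≠ 0 := by
  classical
  intro h
  have h1 := congrArg (MvPolynomial.coeff (asmExponent (oneASM n))) h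
  rw [numerator, MvPolynomial.coeff_sum, MvPolynomial.coeff_zero] at h1
  simp only [MvPolynomial.coeff_monomial, (asmExponent_injective n).eq_iff] at h1
  -- Distinct ASMs have distinct exponents, so only the identity contributes to this coefficient.
  rw [Finset.sum_ite_eq' Finset.univ, if_pos (Finset.mem_univ _)] at h1
  exact Finset.prod_ne_zero_iff.2 (fun i _ => Finset.prod_ne_zero_iff.2 fun j _ =>
    paramWeight_one_ne_zero lam mu hmu i j) h1

/-- Multiplying by every entry once raises all exponents by 1, from -1, 0, 1 to 0, 1, 2. -/
theorem prod_mul_sum_weight {n : ℕ} (A : Matrix (Fin n) (Fin n) K) (lam mu : ℤ → F)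
    (hA : ∀ i j, A i j ≠ 0) :
    (∏ i, ∏ j, A i j) * ∑ B : ASM n, ∏ i, ∏ j,
        weight A B (fun a => algebraMap F K (lam a)) (fun a => algebraMap F K (mu a)) i j =
      MvPolynomial.aeval (fun x : Fin n × Fin n => A x.1 x.2) (numerator n lam mu) := by
  rw [numerator, map_sum, Finset.mul_sum]
  refine Finset.sum_congr rfl fun B _ => ?_
  rw [MvPolynomial.aeval_monomial, Finsupp.prod_fintype _ _ (by simp), Fintype.prod_prod_type,
    map_prod]
  simp only [map_prod, ← Finset.prod_mul_distrib]
  refine Finset.prod_congr rfl fun i _ => Finset.prod_congr rfl fun j _ => ?_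
  have h : weight A B (fun a => algebraMap F K (lam a)) (fun a => algebraMap F K (mu a)) i j =
      A i j ^ B.1 i j * algebraMap F K (paramWeight B lam mu i j) := by
    rw [← paramWeight_algebraMap]
    rfl
  have h2 : A i j ^ (asmExponent B (i, j)) = A i j * A i j ^ B.1 i j := by
    rw [← zpow_one_add₀ (hA i j), ← zpow_natCast]
    congr 1
    simp only [asmExponent, Finsupp.equivFunOnFinite_symm_apply_apply]
    have := B.2.entry i j
    omega
  rw [h, h2]
  ring

theorem sum_weight_ne_zero {n : ℕ} (A : Matrix (Fin n) (Fin n) K) (lam mu : ℤ → F)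
    (hA : AlgebraicIndependent F (fun x : Fin n × Fin n => A x.1 x.2))
    (hmu : ∀ a : ℤ, |a| ≤ (n : ℤ) - 2 → mu a ≠ 0) :
    ∑ B : ASM n, ∏ i, ∏ j,
      weight A B (fun a => algebraMap F K (lam a)) (fun a => algebraMap F K (mu a)) i j ≠ 0 := by
  intro h
  have h1 := prod_mul_sum_weight A lam mu fun i j => hA.ne_zero (i, j)
  rw [h, mul_zero] at h1
  refine numerator_ne_zero lam mu hmu ?_
  exact (injective_iff_map_eq_zero _).1 hA _ h1.symm

theorem algebraicIndependent_submatrix {n m : ℕ} {A : Matrix (Fin n) (Fin n) K}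
    (hA : AlgebraicIndependent F (fun x : Fin n × Fin n => A x.1 x.2)) {f g : Fin m → Fin n}
    (hf : Function.Injective f) (hg : Function.Injective g) :
    AlgebraicIndependent F (fun x : Fin m × Fin m => A.submatrix f g x.1 x.2) :=
  hA.comp (Prod.map f g) (hf.prodMap hg)

/-- Strong induction: the minors are again algebraically independent, and the interior, already
condensable, has the ASM expansion, which is nonzero. -/
theorem condensable_of_algebraicIndependent (n : ℕ) (A : Matrix (Fin n) (Fin n) K)
    (lam mu : ℤ → F) (hA : AlgebraicIndependent F (fun x : Fin n × Fin n => A x.1 x.2))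
    (hmu : ∀ a : ℤ, |a| ≤ (n : ℤ) - 2 → mu a ≠ 0) :
    Condensable n A (fun a => algebraMap F K (lam a)) (fun a => algebraMap F K (mu a)) := by
  induction n using Nat.strong_induction_on generalizing lam mu with
  | _ n ih =>
  match n, A, hA, hmu, ih with
  | 0, _, _, _, _ => trivial
  | 1, _, _, _, _ => trivial
  | n + 2, A, hA, hmu, ih =>
    have hs := Fin.succ_injective (n + 1)
    have hc := Fin.castSucc_injective (n + 1)
    have hi : Function.Injective fun i : Fin n => i.castSucc.succ :=
      (Fin.succ_injective _).comp (Fin.castSucc_injective _)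
    -- Erasing a row and a column shrinks the index range by 1 on each side, which absorbs the
    -- shift.
    have hmu' : ∀ c : ℤ, |c| ≤ 1 → ∀ a : ℤ, |a| ≤ ((n + 1 : ℕ) : ℤ) - 2 → shift c mu a ≠ 0 := by
      intro c hc a ha
      refine hmu _ ?_
      have := abs_add_le a c
      push_cast at *
      omega
    have hmu0 : ∀ a : ℤ, |a| ≤ ((n + 1 : ℕ) : ℤ) - 2 → mu a ≠ 0 := by
      intro a ha
      refine hmu _ ?_
      push_cast at *
      omega
    have hmu1 : ∀ a : ℤ, |a| ≤ (n : ℤ) - 2 → mu a ≠ 0 := by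
      intro a ha
      refine hmu _ ?_
      push_cast at *
      omega
    have hindep := algebraicIndependent_submatrix hA hi hi
    have hcond := ih n (by omega) (interior A) lam mu hindep hmu1
    refine ⟨ih (n + 1) (by omega) (minorFF A) lam (shift 1 mu)
        (algebraicIndependent_submatrix hA hs hs) (hmu' 1 (by simp)),
      ih (n + 1) (by omega) (minorLL A) lam (shift (-1) mu)
        (algebraicIndependent_submatrix hA hc hc) (hmu' (-1) (by simp)),
      ih (n + 1) (by omega) (minorFL A) (shift (-1) lam) mu
        (algebraicIndependent_submatrix hA hs hc) hmu0,
      ih (n + 1) (by omega) (minorLF A) (shift 1 lam) mu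
        (algebraicIndependent_submatrix hA hc hs) hmu0, hcond, ?_⟩
    rw [lambdaDet_eq_sum _ _ _ _ hcond]
    exact sum_weight_ne_zero _ lam mu hindep hmu1

theorem algebraicIndependent_genericMatrix (F : Type*) [Field F] (n : ℕ) :
    AlgebraicIndependent F (fun x : Fin n × Fin n => genericMatrix F n x.1 x.2) :=
  (MvPolynomial.algebraicIndependent_X (Fin n × Fin n) F).map'
    (f := IsScalarTower.toAlgHom F (MvPolynomial (Fin n × Fin n) F) (GenericField F n))
    (IsFractionRing.injective _ _)

end Generic

end LambdaDet

theorem mainTheorem1 {F : Type*} [Field F] (n : ℕ) (lam mu : ℤ → F) :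
    (∀ A : Matrix (Fin n) (Fin n) F, LambdaDet.Condensable n A lam mu →
      LambdaDet.lambdaDet n A lam mu =
        ∑ B : LambdaDet.ASM n, ∏ i, ∏ j, LambdaDet.weight A B lam mu i j) ∧
    ((∀ a : ℤ, |a| ≤ (n : ℤ) - 2 → lam a ≠ 0 ∧ mu a ≠ 0) →
      LambdaDet.Condensable n (LambdaDet.genericMatrix F n)
        (LambdaDet.constParam n lam) (LambdaDet.constParam n mu) ∧
      LambdaDet.lambdaDet n (LambdaDet.genericMatrix F n)
          (LambdaDet.constParam n lam) (LambdaDet.constParam n mu) =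
        ∑ B : LambdaDet.ASM n, ∏ i, ∏ j,
          LambdaDet.weight (LambdaDet.genericMatrix F n) B
            (LambdaDet.constParam n lam) (LambdaDet.constParam n mu) i j) := by
  refine ⟨fun A hA => LambdaDet.lambdaDet_eq_sum n A lam mu hA, fun h => ?_⟩
  have hgen := LambdaDet.condensable_of_algebraicIndependent n (LambdaDet.genericMatrix F n) lam mu
    (LambdaDet.algebraicIndependent_genericMatrix F n) fun a ha => (h a ha).2
  exact ⟨hgen, LambdaDet.lambdaDet_eq_sum n _ _ _ hgen⟩
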